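/- Let $d\ge 1$ and let $\Omega$ be a compact Hausdorff space with an action $\tau$ of $\mathbb Z^d$ by homeomorphisms. Let $\mathcal A_d=C(\Omega)\rtimes_\tau\mathbb Z^d$ be the crossed product, i.e. the universal unital $C^*$-algebra generated by a unital copy of $C(\Omega)$ and commuting unitaries $u_1,\dots,u_d$ with $f u^{n}=u^{n}(f\circ\tau_n)$, where $u^n=u_1^{n_1}\cdots u_d^{n_d}$, for $f\in C(\Omega)$ and $n\in\mathbb Z^d$. Let $\widehat{\mathcal A}_d$ (the half-space algebra) be the universal unital $C^*$-algebra generated by a unital copy of $C(\Omega)$, commuting unitaries $\hat u_1,\dots,\hat u_{d-1}$ and an isometry $\hat u_d$ commuting with them, such that, with $\hat p=1-\hat u_d\hat u_d^*$, $$ f\hat p=\hat p f,\qquad f\hat u_j=\hat u_j\,(f\circ\tau_{e_j}),\qquad f\hat u_j^*=\hat u_j^*\,(f\circ\tau_{-e_j}),\qquad f\in C(\Omega),\ j=1,\dots,d, $$ where $e_j$ is the $j$-th generator of $\mathbb Z^d$. Let $\widetilde{\mathcal A}_d$ (the boundary algebra) be the closed two-sided ideal of $\widehat{\mathcal A}_d$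 generated by $\hat p$, and let $\mathrm{ev}:\widehat{\mathcal A}_d\to\mathcal A_d$ be the unital $*$-homomorphism with $\mathrm{ev}(f)=f$ and $\mathrm{ev}(\hat u_j)=u_j$; it is applied to matrices entrywise. Let $$\mathrm{Exp}:K_0(\mathcal A_d)\to K_1(\widetilde{\mathcal A}_d)$$ be the exponential connecting map of the exact sequence $0\to\widetilde{\mathcal A}_d\to\widehat{\mathcal A}_d\xrightarrow{\mathrm{ev}}\mathcal A_d\to0$: if $p$ is a projection in a matrix algebra over $\mathcal A_d$ and the self-adjoint matrix $a$ over $\widehat{\mathcal A}_d$ is a lift of $p$, then $\mathrm{Exp}([p]_0-[1_k]_0)=[e^{2\pi i a}]_1$, where $e^{2\pi i a}$ is regarded as a unitary matrix over the unitization of $\widetilde{\mathcal A}_d$. Let $N\in\mathbb N$, let $h\in\mathcal M_N\otimes\mathcal A_d$ be self-adjoint, let $G$ be a spectral gap of $h$, i.e. a connected component of $\mathbb R\setminus\mathrm{Spec}(h)$, and let $p_G=\chi(h\le G)$ be the spectral projection of $h$ onto the part of its spectrum below $G$. Assume that $\mathrm{Exp}([p_G]_0)$ differs from the class of the (adjoined)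 identity in $K_1(\widetilde{\mathcal A}_d)$. Then for every self-adjoint $\hat h\in\mathcal M_N\otimes\widehat{\mathcal A}_d$ with $\mathrm{ev}(\hat h)=h$, the boundary spectrum $\mathrm{Spec}_B(\hat h)=\mathrm{Spec}(\hat h)\setminus\mathrm{Spec}(h)$ satisfies $$\mathrm{Spec}_B(\hat h)\cap G=G .$$ -/

import Mathlib

universe u v

/-- The free unital complex `*`-algebra on a set `X`: complex linear combinations of words in the
letters `x` (written `Sum.inl x`) and their formal adjoints (written `Sum.inr x`). -/
abbrev FreeStarAlgebra (X : Type u) : Type u := MonoidAlgebra ℂ (FreeMonoid (X ⊕ X))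

namespace FreeStarAlgebra

variable {X : Type u}

/-- The adjoint of a word: reverse it and exchange each letter with its formal adjoint. -/
def wordStar (w : FreeMonoid (X ⊕ X)) : FreeMonoid (X ⊕ X) := FreeMonoid.map Sum.swap (star w)

theorem wordStar_mul (w w' : FreeMonoid (X ⊕ X)) :
    wordStar (w * w') = wordStar w' * wordStar w := by
  simp [wordStar]

theorem wordStar_wordStar (w : FreeMonoid (X ⊕ X)) : wordStar (wordStar w) = w := by
  induction w using FreeMonoid.inductionOn' with
  | one => simp [wordStar]
  | of_mul x w ih => rw [wordStar_mul, wordStar_mul, ih]; simp [wordStar]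

/-- The conjugate linear extension of the adjoint of words. -/
noncomputable def starAddHom : FreeStarAlgebra X →+ FreeStarAlgebra X where
  toFun a := MonoidAlgebra.mapDomain wordStar
    (MonoidAlgebra.map ((starRingEnd ℂ : ℂ →+* ℂ) : ℂ →+ ℂ) a)
  map_zero' := by simp
  map_add' a b := by rw [MonoidAlgebra.map_add, MonoidAlgebra.mapDomain_add]

theorem starAddHom_single (w : FreeMonoid (X ⊕ X)) (c : ℂ) :
    starAddHom (MonoidAlgebra.single w c) =
      MonoidAlgebra.single (wordStar w) ((starRingEnd ℂ) c) := by
  simp [starAddHom]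

noncomputable instance : StarRing (FreeStarAlgebra X) where
  star := starAddHom
  star_involutive a := by
    show starAddHom (starAddHom a) = a
    induction a using MonoidAlgebra.induction_linear with
    | zero => simp
    | single w c => simp [starAddHom_single, wordStar_wordStar]
    | add a b h1 h2 => simp [h1, h2]
  star_mul a b := by
    show starAddHom (a * b) = starAddHom b * starAddHom a
    induction a using MonoidAlgebra.induction_linear with
    | zero => simp
    | add a a' h1 h2 => simp [h1, h2, add_mul, mul_add]
    | single w c =>
      induction b using MonoidAlgebra.induction_linear with
      | zero => simp
      | add a a' h1 h2 => simp [h1, h2, add_mul, mul_add]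
      | single w' c' =>
        simp only [starAddHom_single, MonoidAlgebra.single_mul_single, wordStar_mul, map_mul]
        rw [mul_comm]
  star_add a b := map_add starAddHom a b

theorem star_single (w : FreeMonoid (X ⊕ X)) (c : ℂ) :
    star (MonoidAlgebra.single w c : FreeStarAlgebra X) =
      MonoidAlgebra.single (wordStar w) (star c) := starAddHom_single w c

instance : StarModule ℂ (FreeStarAlgebra X) where
  star_smul c a := by
    induction a using MonoidAlgebra.induction_linear with
    | zero => simp
    | add a a' h1 h2 => simp only [smul_add, star_add, h1, h2]
    | single w c' => simp [star_single]

/-- The generator `x`. -/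
noncomputable def of (x : X) : FreeStarAlgebra X :=
  MonoidAlgebra.single (FreeMonoid.of (Sum.inl x)) 1

theorem star_of (x : X) :
    star (of x) = MonoidAlgebra.single (FreeMonoid.of (Sum.inr x)) 1 := by
  rw [of, star_single]; simp [wordStar]

theorem lift_wordStar {B : Type v} [Monoid B] [StarMul B] (φ : X → B) (w : FreeMonoid (X ⊕ X)) :
    FreeMonoid.lift (Sum.elim φ (fun x => star (φ x))) (wordStar w) =
      star (FreeMonoid.lift (Sum.elim φ (fun x => star (φ x))) w) := by
  induction w using FreeMonoid.inductionOn' with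
  | one => simp [wordStar]
  | of_mul x w ih =>
    rw [wordStar_mul, map_mul, map_mul, star_mul, ih]
    congr 1
    rcases x with x | x <;> simp [wordStar]

/-- The unital `*`-homomorphism with prescribed values on the generators. -/
noncomputable def lift {B : Type v} [Ring B] [StarRing B] [Algebra ℂ B] [StarModule ℂ B]
    (φ : X → B) : FreeStarAlgebra X →⋆ₐ[ℂ] B where
  toAlgHom := MonoidAlgebra.lift ℂ B _ (FreeMonoid.lift (Sum.elim φ (fun x => star (φ x))))
  map_star' a := by
    show MonoidAlgebra.lift ℂ B _ _ (star a) = star (MonoidAlgebra.lift ℂ B _ _ a)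
    induction a using MonoidAlgebra.induction_linear with
    | zero => simp
    | add a b h1 h2 => rw [star_add, map_add, h1, h2, map_add, star_add]
    | single w c => simp [star_single, lift_wordStar]

@[simp]
theorem lift_of {B : Type v} [Ring B] [StarRing B] [Algebra ℂ B] [StarModule ℂ B]
    (φ : X → B) (x : X) : lift φ (of x) = φ x := by
  show MonoidAlgebra.lift ℂ B _ (FreeMonoid.lift (Sum.elim φ (fun x => star (φ x))))
    (MonoidAlgebra.single (FreeMonoid.of (Sum.inl x)) 1) = _
  simp

theorem hom_ext {B : Type v} [Ring B] [StarRing B] [Algebra ℂ B]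
    {f g : FreeStarAlgebra X →⋆ₐ[ℂ] B} (h : ∀ x, f (of x) = g (of x)) : f = g := by
  ext a
  induction a using MonoidAlgebra.induction_linear with
  | zero => rw [map_zero, map_zero]
  | add a b h1 h2 => rw [map_add, map_add, h1, h2]
  | single w c =>
    have hw : f (MonoidAlgebra.single w 1) = g (MonoidAlgebra.single w 1) := by
      induction w using FreeMonoid.inductionOn' with
      | one => exact (map_one f).trans (map_one g).symm
      | of_mul x w ih =>
        have hm : (MonoidAlgebra.single (FreeMonoid.of x * w) 1 : FreeStarAlgebra X) =
            MonoidAlgebra.single (FreeMonoid.of x) 1 * MonoidAlgebra.single w 1 := by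
          rw [MonoidAlgebra.single_mul_single, one_mul]
        rw [hm, map_mul, map_mul, ih]
        congr 1
        rcases x with x | x
        · exact h x
        · rw [← star_of, map_star, map_star, h]
    have hc : (MonoidAlgebra.single w c : FreeStarAlgebra X) =
        c • MonoidAlgebra.single w (1 : ℂ) := by simp
    rw [hc, map_smul, map_smul, hw]

end FreeStarAlgebra

/-- Generators and relations for a unital `C*`-algebra: relations `a = b` between elements of the
free `*`-algebra, and for each generator `x` a norm relation `‖x‖ ≤ bound x`. -/
structure CStarPresentation (X : Type u) where
  rel : FreeStarAlgebra X → FreeStarAlgebra X → Prop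
  bound : X → NNReal

namespace CStarPresentation

variable {X : Type u} (P : CStarPresentation X)

/-- A `C*`-seminorm on the free `*`-algebra that is compatible with the relations. These are the
functions `a ↦ ‖ρ a‖` for the representations `ρ` of the generators and relations in
`C*`-algebras. -/
structure IsAdmissible (p : Seminorm ℂ (FreeStarAlgebra X)) : Prop where
  mul_le : ∀ a b, p (a * b) ≤ p a * p b
  star_mul_self : ∀ a, p (star a * a) = p a ^ 2
  rel : ∀ a b, P.rel a b → p (a - b) = 0
  of_le : ∀ x, p (FreeStarAlgebra.of x) ≤ P.bound x

variable {P}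

theorem IsAdmissible.star_eq {p : Seminorm ℂ (FreeStarAlgebra X)} (hp : P.IsAdmissible p)
    (a : FreeStarAlgebra X) : p (star a) = p a := by
  have key : ∀ a, p a ≤ p (star a) := fun a => by
    rcases (apply_nonneg p a).eq_or_lt with h | h
    · rw [← h]; exact apply_nonneg p _
    · have := hp.star_mul_self a ▸ hp.mul_le (star a) a
      rw [sq] at this
      exact le_of_mul_le_mul_right this h
  refine le_antisymm ?_ (key a)
  simpa using key (star a)

theorem IsAdmissible.one_le {p : Seminorm ℂ (FreeStarAlgebra X)} (hp : P.IsAdmissible p) :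
    p 1 ≤ 1 := by
  have := hp.star_mul_self 1
  rw [star_one, one_mul] at this
  nlinarith [apply_nonneg p 1]

theorem isAdmissible_zero : P.IsAdmissible 0 where
  mul_le _ _ := by simp
  star_mul_self _ := by simp
  rel _ _ _ := by simp
  of_le x := by simp

instance : Nonempty {p // P.IsAdmissible p} := ⟨⟨0, isAdmissible_zero⟩⟩

variable (P) in
theorem exists_bound (a : FreeStarAlgebra X) : ∃ C, ∀ p, P.IsAdmissible p → p a ≤ C := by
  induction a using MonoidAlgebra.induction_linear with
  | zero => exact ⟨0, fun p _ => by simp⟩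
  | add a b h1 h2 =>
    obtain ⟨C, hC⟩ := h1
    obtain ⟨D, hD⟩ := h2
    exact ⟨C + D, fun p hp => (map_add_le_add p a b).trans (add_le_add (hC p hp) (hD p hp))⟩
  | single w c =>
    have h1 : ∃ C, ∀ p, P.IsAdmissible p → p (MonoidAlgebra.single w (1 : ℂ)) ≤ C := by
      induction w using FreeMonoid.inductionOn' with
      | one => exact ⟨1, fun p hp => hp.one_le⟩
      | of_mul x w ih =>
        obtain ⟨C, hC⟩ := ih
        have hx : ∃ D : NNReal, ∀ p, P.IsAdmissible p →
            p (MonoidAlgebra.single (FreeMonoid.of x) (1 : ℂ)) ≤ D := by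
          rcases x with x | x
          · exact ⟨P.bound x, fun p hp => hp.of_le x⟩
          · refine ⟨P.bound x, fun p hp => ?_⟩
            rw [← FreeStarAlgebra.star_of, hp.star_eq]
            exact hp.of_le x
        obtain ⟨D, hD⟩ := hx
        refine ⟨D * C, fun p hp => ?_⟩
        have := hp.mul_le (MonoidAlgebra.single (FreeMonoid.of x) (1 : ℂ))
          (MonoidAlgebra.single w (1 : ℂ))
        rw [MonoidAlgebra.single_mul_single, one_mul] at this
        exact this.trans (mul_le_mul (hD p hp) (hC p hp) (apply_nonneg p _) D.2)
    obtain ⟨C, hC⟩ := h1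
    refine ⟨‖c‖ * C, fun p hp => ?_⟩
    have : (MonoidAlgebra.single w c : FreeStarAlgebra X) =
        c • MonoidAlgebra.single w (1 : ℂ) := by simp
    rw [this, map_smul_eq_mul]
    exact mul_le_mul_of_nonneg_left (hC p hp) (norm_nonneg c)

variable (P) in
/-- The universal seminorm: the supremum of all admissible `C*`-seminorms. -/
noncomputable def univNorm (a : FreeStarAlgebra X) : ℝ := ⨆ p : {p // P.IsAdmissible p}, p.1 a

theorem bddAbove (a : FreeStarAlgebra X) :
    BddAbove (Set.range fun p : {p // P.IsAdmissible p} => p.1 a) := by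
  obtain ⟨C, hC⟩ := P.exists_bound a
  exact ⟨C, by rintro _ ⟨p, rfl⟩; exact hC p.1 p.2⟩

theorem IsAdmissible.le_univNorm {p : Seminorm ℂ (FreeStarAlgebra X)} (hp : P.IsAdmissible p)
    (a : FreeStarAlgebra X) : p a ≤ P.univNorm a :=
  le_ciSup (bddAbove a) (⟨p, hp⟩ : {p // P.IsAdmissible p})

theorem univNorm_le {a : FreeStarAlgebra X} {C : ℝ} (h : ∀ p, P.IsAdmissible p → p a ≤ C) :
    P.univNorm a ≤ C := ciSup_le fun p => h p.1 p.2

theorem univNorm_nonneg (a : FreeStarAlgebra X) : 0 ≤ P.univNorm a :=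
  isAdmissible_zero.le_univNorm (P := P) a

variable (P) in
/-- The universal seminorm is itself admissible. -/
noncomputable def univSeminorm : Seminorm ℂ (FreeStarAlgebra X) :=
  Seminorm.of P.univNorm
    (fun a b => univNorm_le fun p hp => (map_add_le_add p a b).trans
      (add_le_add (hp.le_univNorm a) (hp.le_univNorm b)))
    (fun c a => by
      simp only [univNorm, map_smul_eq_mul]
      rw [Real.mul_iSup_of_nonneg (norm_nonneg c)])

variable (P) in
theorem isAdmissible_univSeminorm : P.IsAdmissible P.univSeminorm where
  mul_le a b := univNorm_le fun p hp => (hp.mul_le a b).trans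
    (mul_le_mul (hp.le_univNorm a) (hp.le_univNorm b) (apply_nonneg p b) (univNorm_nonneg a))
  star_mul_self a := by
    show P.univNorm _ = P.univNorm a ^ 2
    refine le_antisymm (univNorm_le fun p hp => ?_) ?_
    · rw [hp.star_mul_self]
      exact pow_le_pow_left₀ (apply_nonneg p a) (hp.le_univNorm a) 2
    · rw [← Real.le_sqrt (univNorm_nonneg _) (univNorm_nonneg _)]
      refine univNorm_le fun p hp => Real.le_sqrt_of_sq_le ?_
      rw [← hp.star_mul_self]
      exact hp.le_univNorm _
  rel a b h := le_antisymm (univNorm_le fun p hp => (hp.rel a b h).le) (univNorm_nonneg _)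
  of_le x := univNorm_le fun p hp => hp.of_le x

/-- The free `*`-algebra, to be equipped with the universal seminorm of `P`. -/
def Pre {X : Type u} (_P : CStarPresentation X) : Type u := FreeStarAlgebra X

noncomputable instance : Ring P.Pre := inferInstanceAs (Ring (FreeStarAlgebra X))

noncomputable instance : Algebra ℂ P.Pre := inferInstanceAs (Algebra ℂ (FreeStarAlgebra X))

noncomputable instance : StarRing P.Pre := inferInstanceAs (StarRing (FreeStarAlgebra X))

instance : StarModule ℂ P.Pre := inferInstanceAs (StarModule ℂ (FreeStarAlgebra X))

variable (P) in
noncomputable def toPre : FreeStarAlgebra X ≃⋆ₐ[ℂ] P.Pre := StarAlgEquiv.refl ℂ (FreeStarAlgebra X)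

variable (P) in
noncomputable def preSeminorm : RingSeminorm P.Pre where
  toFun := P.univSeminorm
  map_zero' := map_zero P.univSeminorm
  add_le' := map_add_le_add P.univSeminorm
  neg' := map_neg_eq_map P.univSeminorm
  mul_le' := P.isAdmissible_univSeminorm.mul_le

noncomputable instance : SeminormedRing P.Pre where
  __ := P.preSeminorm.toAddGroupSeminorm.toSeminormedAddCommGroup
  __ : Ring P.Pre := inferInstance
  norm_mul_le := map_mul_le_mul P.preSeminorm

theorem norm_toPre (a : FreeStarAlgebra X) : ‖P.toPre a‖ = P.univNorm a := rfl

theorem norm_pre (a : P.Pre) : ‖a‖ = P.univNorm (P.toPre.symm a) := rfl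

noncomputable instance : NormedAlgebra ℂ P.Pre where
  norm_smul_le c a := (map_smul_eq_mul P.univSeminorm c a).le

theorem norm_star_mul_self_pre (a : P.Pre) : ‖star a * a‖ = ‖a‖ * ‖a‖ :=
  (P.isAdmissible_univSeminorm.star_mul_self a).trans (sq _)

instance : NormedStarGroup P.Pre where
  norm_star_le a := (P.isAdmissible_univSeminorm.star_eq a).le

theorem uniformContinuous_star_pre : UniformContinuous (star : P.Pre → P.Pre) :=
  (starNormedAddGroupHom (E := P.Pre)).uniformContinuous

end CStarPresentation

open UniformSpace in
/-- The universal unital `C*`-algebra of a presentation: the Hausdorff completion of the free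
`*`-algebra with respect to the universal seminorm. -/
abbrev UniversalCStarAlgebra {X : Type u} (P : CStarPresentation X) : Type u := Completion P.Pre

namespace UniversalCStarAlgebra

open UniformSpace

variable {X : Type u} {P : CStarPresentation X}

noncomputable instance : StarRing (UniversalCStarAlgebra P) where
  star := Completion.map star
  star_involutive a := by
    show Completion.map star (Completion.map star a) = a
    induction a using Completion.induction_on with
    | hp =>
      exact isClosed_eq (Completion.continuous_map.comp Completion.continuous_map)
        continuous_id
    | ih a => rw [Completion.map_coe CStarPresentation.uniformContinuous_star_pre,
        Completion.map_coe CStarPresentation.uniformContinuous_star_pre, star_star]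
  star_mul a b := by
    show Completion.map star (a * b) = Completion.map star b * Completion.map star a
    induction a, b using Completion.induction_on₂ with
    | hp =>
      exact isClosed_eq (Completion.continuous_map.comp continuous_mul)
        (continuous_mul.comp ((Completion.continuous_map.comp continuous_snd).prodMk
          (Completion.continuous_map.comp continuous_fst)))
    | ih a b =>
      simp only [← Completion.coe_mul, Completion.map_coe CStarPresentation.uniformContinuous_star_pre, star_mul]
  star_add a b := by
    show Completion.map star (a + b) = Completion.map star a + Completion.map star b
    induction a, b using Completion.induction_on₂ with
    | hp =>
      exact isClosed_eq (Completion.continuous_map.comp continuous_add)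
        (continuous_add.comp ((Completion.continuous_map.comp continuous_fst).prodMk
          (Completion.continuous_map.comp continuous_snd)))
    | ih a b =>
      simp only [← Completion.coe_add, Completion.map_coe CStarPresentation.uniformContinuous_star_pre, star_add]

theorem continuous_star' : Continuous (star : UniversalCStarAlgebra P → UniversalCStarAlgebra P) :=
  Completion.continuous_map

theorem coe_star (a : P.Pre) : ((star a : P.Pre) : UniversalCStarAlgebra P) = star (a : UniversalCStarAlgebra P) :=
  (Completion.map_coe CStarPresentation.uniformContinuous_star_pre a).symm

instance : StarModule ℂ (UniversalCStarAlgebra P) where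
  star_smul c a := by
    induction a using Completion.induction_on with
    | hp =>
      exact isClosed_eq (continuous_star'.comp (continuous_const_smul c))
        ((continuous_const_smul (star c)).comp continuous_star')
    | ih a => rw [← Completion.coe_smul, ← coe_star, ← coe_star, star_smul, Completion.coe_smul]

noncomputable instance : CStarAlgebra (UniversalCStarAlgebra P) where
  norm_smul_le := norm_smul_le
  norm_mul_self_le a := by
    induction a using Completion.induction_on with
    | hp =>
      exact isClosed_le (continuous_norm.mul continuous_norm)
        (continuous_norm.comp (continuous_star'.mul continuous_id))
    | ih a =>
      rw [← coe_star, ← Completion.coe_mul, Completion.norm_coe, Completion.norm_coe,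
        CStarPresentation.norm_star_mul_self_pre]

noncomputable instance : PartialOrder (UniversalCStarAlgebra P) := CStarAlgebra.spectralOrder _

instance : StarOrderedRing (UniversalCStarAlgebra P) := CStarAlgebra.spectralOrderedRing _

variable (P) in
/-- The canonical map from the free `*`-algebra to the universal `C*`-algebra. -/
noncomputable def mk : FreeStarAlgebra X →⋆ₐ[ℂ] UniversalCStarAlgebra P where
  toFun a := (P.toPre a : P.Pre)
  map_one' := by rw [map_one, Completion.coe_one]
  map_mul' a b := by rw [map_mul, Completion.coe_mul]
  map_zero' := by rw [map_zero, Completion.coe_zero]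
  map_add' a b := by rw [map_add, Completion.coe_add]
  commutes' c := by
    rw [Algebra.algebraMap_eq_smul_one, Algebra.algebraMap_eq_smul_one, map_smul, map_one,
      Completion.coe_smul, Completion.coe_one]
  map_star' a := by rw [map_star, coe_star]

theorem norm_mk (a : FreeStarAlgebra X) : ‖mk P a‖ = P.univNorm a :=
  (Completion.norm_coe _).trans (CStarPresentation.norm_toPre a)

theorem denseRange_mk : DenseRange (mk P) :=
  Completion.denseRange_coe.comp P.toPre.surjective.denseRange (Completion.continuous_coe _)

theorem mk_eq_of_rel {a b : FreeStarAlgebra X} (h : P.rel a b) : mk P a = mk P b := by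
  rw [← sub_eq_zero, ← map_sub, ← norm_eq_zero, norm_mk]
  exact P.isAdmissible_univSeminorm.rel a b h

variable (P) in
/-- The image of a generator in the universal `C*`-algebra. -/
noncomputable def gen (x : X) : UniversalCStarAlgebra P := mk P (FreeStarAlgebra.of x)

theorem norm_gen_le (x : X) : ‖gen P x‖ ≤ P.bound x :=
  (norm_mk _).trans_le (P.isAdmissible_univSeminorm.of_le x)

theorem lift_gen_eq_mk : FreeStarAlgebra.lift (gen P) = mk P :=
  FreeStarAlgebra.hom_ext fun x => FreeStarAlgebra.lift_of _ x

theorem norm_lift_le {B : Type v} [CStarAlgebra B] (φ : X → B)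
    (hrel : ∀ a b, P.rel a b → FreeStarAlgebra.lift φ a = FreeStarAlgebra.lift φ b)
    (hbound : ∀ x, ‖φ x‖ ≤ P.bound x) (a : FreeStarAlgebra X) :
    ‖FreeStarAlgebra.lift φ a‖ ≤ P.univNorm a := by
  let p : Seminorm ℂ (FreeStarAlgebra X) :=
    (normSeminorm ℂ B).comp (FreeStarAlgebra.lift φ).toAlgHom.toLinearMap
  have hpa : ∀ a, p a = ‖FreeStarAlgebra.lift φ a‖ := fun _ => rfl
  have hp : P.IsAdmissible p :=
    { mul_le := fun a b => by simp only [hpa, map_mul]; exact norm_mul_le _ _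
      star_mul_self := fun a => by
        simp only [hpa, map_mul, map_star]; rw [CStarRing.norm_star_mul_self, sq]
      rel := fun a b h => by rw [hpa, map_sub, hrel a b h, sub_self, norm_zero]
      of_le := fun x => by rw [hpa, FreeStarAlgebra.lift_of]; exact hbound x }
  exact hp.le_univNorm a

theorem continuous_preLift {B : Type v} [CStarAlgebra B] (φ : X → B)
    (hrel : ∀ a b, P.rel a b → FreeStarAlgebra.lift φ a = FreeStarAlgebra.lift φ b)
    (hbound : ∀ x, ‖φ x‖ ≤ P.bound x) :
    Continuous (((FreeStarAlgebra.lift φ).comp (P.toPre.symm : P.Pre →⋆ₐ[ℂ] _) :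
      P.Pre →⋆ₐ[ℂ] B) : P.Pre →+* B) :=
  AddMonoidHomClass.continuous_of_bound _ 1 fun a => by
    rw [one_mul, CStarPresentation.norm_pre]
    exact norm_lift_le φ hrel hbound (P.toPre.symm a)

/-- The universal property: elements of a `C*`-algebra satisfying the relations induce a unital
`*`-homomorphism from the universal `C*`-algebra. -/
noncomputable def lift {B : Type v} [CStarAlgebra B] (φ : X → B)
    (hrel : ∀ a b, P.rel a b → FreeStarAlgebra.lift φ a = FreeStarAlgebra.lift φ b)
    (hbound : ∀ x, ‖φ x‖ ≤ P.bound x) : UniversalCStarAlgebra P →⋆ₐ[ℂ] B where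
  toRingHom := Completion.extensionHom _ (continuous_preLift φ hrel hbound)
  commutes' c := by
    have : algebraMap ℂ (UniversalCStarAlgebra P) c = mk P (algebraMap ℂ _ c) :=
      (AlgHomClass.commutes (mk P) c).symm
    show Completion.extensionHom _ (continuous_preLift φ hrel hbound) _ = _
    rw [this]
    exact (Completion.extensionHom_coe _ (continuous_preLift φ hrel hbound) _).trans
      (AlgHomClass.commutes (FreeStarAlgebra.lift φ) c)
  map_star' a := by
    show Completion.extensionHom _ (continuous_preLift φ hrel hbound) _ =
      star (Completion.extensionHom _ (continuous_preLift φ hrel hbound) _)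
    induction a using Completion.induction_on with
    | hp =>
      exact isClosed_eq (Completion.continuous_extension.comp continuous_star')
        (Completion.continuous_extension.star)
    | ih a =>
      rw [← coe_star, Completion.extensionHom_coe, Completion.extensionHom_coe]
      exact map_star (FreeStarAlgebra.lift φ) (P.toPre.symm a)

theorem lift_mk {B : Type v} [CStarAlgebra B] (φ : X → B)
    (hrel : ∀ a b, P.rel a b → FreeStarAlgebra.lift φ a = FreeStarAlgebra.lift φ b)
    (hbound : ∀ x, ‖φ x‖ ≤ P.bound x) (a : FreeStarAlgebra X) :
    lift φ hrel hbound (mk P a) = FreeStarAlgebra.lift φ a :=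
  Completion.extensionHom_coe _ (continuous_preLift φ hrel hbound) _

theorem lift_gen {B : Type v} [CStarAlgebra B] (φ : X → B)
    (hrel : ∀ a b, P.rel a b → FreeStarAlgebra.lift φ a = FreeStarAlgebra.lift φ b)
    (hbound : ∀ x, ‖φ x‖ ≤ P.bound x) (x : X) :
    lift φ hrel hbound (gen P x) = φ x := by
  rw [gen, lift_mk, FreeStarAlgebra.lift_of]

end UniversalCStarAlgebra

set_option linter.unusedSectionVars false

namespace BulkBoundary

section Observables

variable (Ω : Type u) [TopologicalSpace Ω] [CompactSpace Ω] (d : ℕ)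
  [AddAction (Fin (d + 1) → ℤ) Ω] [ContinuousConstVAdd (Fin (d + 1) → ℤ) Ω]

/-- The generators: continuous functions on `Ω`, and one further generator for each of the
`d + 1` coordinate directions of the lattice. -/
abbrev Generator : Type u := C(Ω, ℂ) ⊕ Fin (d + 1)

variable {Ω d}

/-- The function `f ∘ τ_n`. -/
noncomputable def shift (n : Fin (d + 1) → ℤ) (f : C(Ω, ℂ)) : C(Ω, ℂ) :=
  f.comp ⟨fun ω => n +ᵥ ω, continuous_const_vadd n⟩

/-- The `j`-th generator of the lattice. -/
def e (j : Fin (d + 1)) : Fin (d + 1) → ℤ := Pi.single j 1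

variable (Ω d) in
/-- The formal generator belonging to a continuous function. -/
noncomputable def func (f : C(Ω, ℂ)) : FreeStarAlgebra (Generator Ω d) :=
  FreeStarAlgebra.of (Sum.inl f)

variable (Ω) in
/-- The formal generator `u_j`. -/
noncomputable def u (j : Fin (d + 1)) : FreeStarAlgebra (Generator Ω d) :=
  FreeStarAlgebra.of (Sum.inr j)

/-- Integer powers of an element that is to become unitary: negative powers are powers of the
adjoint. -/
def unitaryZPow {R : Type*} [Monoid R] [Star R] (x : R) : ℤ → R
  | Int.ofNat k => x ^ k
  | Int.negSucc k => star x ^ (k + 1)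

variable (Ω) in
/-- The monomial `u^n = u_1^{n_1} ⋯ u_d^{n_d}`. -/
noncomputable def monomial (n : Fin (d + 1) → ℤ) : FreeStarAlgebra (Generator Ω d) :=
  (List.ofFn fun j => unitaryZPow (u Ω j) (n j)).prod

variable (Ω d) in
/-- The relations saying that the functions form a unital copy of the `*`-algebra `C(Ω)`. -/
inductive FunctionRel : FreeStarAlgebra (Generator Ω d) → FreeStarAlgebra (Generator Ω d) → Prop
  | one : FunctionRel (func Ω d 1) 1
  | add (f g : C(Ω, ℂ)) : FunctionRel (func Ω d (f + g)) (func Ω d f + func Ω d g)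
  | smul (c : ℂ) (f : C(Ω, ℂ)) : FunctionRel (func Ω d (c • f)) (c • func Ω d f)
  | mul (f g : C(Ω, ℂ)) : FunctionRel (func Ω d (f * g)) (func Ω d f * func Ω d g)
  | adjoint (f : C(Ω, ℂ)) : FunctionRel (func Ω d (star f)) (star (func Ω d f))

variable (Ω d) in
/-- The relations of the crossed product: the `u_j` are commuting unitaries and
`f u^n = u^n (f ∘ τ_n)`. -/
inductive BulkRel : FreeStarAlgebra (Generator Ω d) → FreeStarAlgebra (Generator Ω d) → Prop
  | function {a b} : FunctionRel Ω d a b → BulkRel a b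
  | star_mul_self (j : Fin (d + 1)) : BulkRel (star (u Ω j) * u Ω j) 1
  | mul_star_self (j : Fin (d + 1)) : BulkRel (u Ω j * star (u Ω j)) 1
  | comm (i j : Fin (d + 1)) : BulkRel (u Ω i * u Ω j) (u Ω j * u Ω i)
  | covariance (f : C(Ω, ℂ)) (n : Fin (d + 1) → ℤ) :
      BulkRel (func Ω d f * monomial Ω n) (monomial Ω n * func Ω d (shift n f))

/-- The formal element `p̂ = 1 - û_d û_d^*`, where `û_d` belongs to the last direction. -/
noncomputable def formalBoundaryProjection : FreeStarAlgebra (Generator Ω d) :=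
  1 - u Ω (Fin.last d) * star (u Ω (Fin.last d))

variable (Ω d) in
/-- The relations of the half-space algebra: the `û_j` with `j ≠ d` are commuting unitaries, `û_d`
is an isometry commuting with them, and the functions commute with `p̂ = 1 - û_d û_d^*` and satisfy
`f û_j = û_j (f ∘ τ_{e_j})` and `f û_j^* = û_j^* (f ∘ τ_{-e_j})`. The lattice is `ℤ^{d+1}`, and the index
`d` in this comment refers to `Fin.last d`. -/
inductive HalfSpaceRel : FreeStarAlgebra (Generator Ω d) → FreeStarAlgebra (Generator Ω d) → Prop
  | function {a b} : FunctionRel Ω d a b → HalfSpaceRel a b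
  | star_mul_self (j : Fin d) : HalfSpaceRel (star (u Ω j.castSucc) * u Ω j.castSucc) 1
  | mul_star_self (j : Fin d) : HalfSpaceRel (u Ω j.castSucc * star (u Ω j.castSucc)) 1
  | comm (i j : Fin d) :
      HalfSpaceRel (u Ω i.castSucc * u Ω j.castSucc) (u Ω j.castSucc * u Ω i.castSucc)
  | isometry : HalfSpaceRel (star (u Ω (Fin.last d)) * u Ω (Fin.last d)) 1
  | comm_last (j : Fin d) :
      HalfSpaceRel (u Ω (Fin.last d) * u Ω j.castSucc) (u Ω j.castSucc * u Ω (Fin.last d))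
  | comm_projection (f : C(Ω, ℂ)) :
      HalfSpaceRel (func Ω d f * formalBoundaryProjection) (formalBoundaryProjection * func Ω d f)
  | covariance (f : C(Ω, ℂ)) (j : Fin (d + 1)) :
      HalfSpaceRel (func Ω d f * u Ω j) (u Ω j * func Ω d (shift (e j) f))
  | covariance_star (f : C(Ω, ℂ)) (j : Fin (d + 1)) :
      HalfSpaceRel (func Ω d f * star (u Ω j)) (star (u Ω j) * func Ω d (shift (-e j) f))

variable (Ω d) in
/-- The norm relations `‖f‖ ≤ sup |f|` and `‖u_j‖ ≤ 1`. They follow from the algebraic relations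
in every `C*`-algebra and only spare an argument that the universal seminorm is finite. -/
noncomputable def generatorBound : Generator Ω d → NNReal := Sum.elim (fun f => ‖f‖₊) fun _ => 1

variable (Ω d)

noncomputable def bulkPresentation : CStarPresentation (Generator Ω d) where
  rel := BulkRel Ω d
  bound := generatorBound Ω d

noncomputable def halfSpacePresentation : CStarPresentation (Generator Ω d) where
  rel := HalfSpaceRel Ω d
  bound := generatorBound Ω d

/-- The crossed product `C(Ω) ⋊ ℤ^{d+1}`, the algebra of bulk observables. -/
abbrev BulkAlgebra : Type u := UniversalCStarAlgebra (bulkPresentation Ω d)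

/-- The algebra of half-space observables. -/
abbrev HalfSpaceAlgebra : Type u := UniversalCStarAlgebra (halfSpacePresentation Ω d)

variable {Ω d}

theorem prod_ofFn_unitaryZPow {R : Type*} [Monoid R] [Star R] {n : ℕ} (x : Fin n → R)
    (j : Fin n) :
    (List.ofFn fun i => unitaryZPow (x i) ((Pi.single j 1 : Fin n → ℤ) i)).prod = x j := by
  induction n with
  | zero => exact j.elim0
  | succ n ih =>
    rw [List.ofFn_succ, List.prod_cons]
    refine Fin.cases ?_ (fun j => ?_) j
    · have h : (List.ofFn fun i : Fin n =>
          unitaryZPow (x i.succ) ((Pi.single 0 1 : Fin (n + 1) → ℤ) i.succ)).prod = 1 := by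
        refine List.prod_eq_one fun y hy => ?_
        obtain ⟨i, rfl⟩ := List.mem_ofFn.1 hy
        rw [Pi.single_eq_of_ne (Fin.succ_ne_zero i)]
        exact pow_zero _
      rw [h, mul_one, Pi.single_eq_same]
      exact pow_one _
    · rw [Pi.single_eq_of_ne (Fin.succ_ne_zero j).symm]
      have h : (fun i : Fin n => unitaryZPow (x i.succ)
          ((Pi.single j.succ 1 : Fin (n + 1) → ℤ) i.succ)) =
          fun i => unitaryZPow (x i.succ) ((Pi.single j 1 : Fin n → ℤ) i) := by
        funext i
        congr 1
        by_cases hij : i = j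
        · subst hij; simp
        · rw [Pi.single_eq_of_ne hij, Pi.single_eq_of_ne (fun h => hij (Fin.succ_injective _ h))]
      rw [h, ih (fun i => x i.succ) j]
      exact (congrArg (· * x j.succ) (pow_zero (x 0))).trans (one_mul (x j.succ))

theorem monomial_e (j : Fin (d + 1)) : monomial Ω (e j) = u Ω j :=
  prod_ofFn_unitaryZPow (u Ω) j

theorem shift_neg_shift (j : Fin (d + 1)) (f : C(Ω, ℂ)) : shift (-e j) (shift (e j) f) = f := by
  ext ω
  show f (e j +ᵥ (-e j +ᵥ ω)) = f ω
  rw [vadd_vadd, add_neg_cancel, zero_vadd]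

theorem shift_shift_neg (j : Fin (d + 1)) (f : C(Ω, ℂ)) : shift (e j) (shift (-e j) f) = f := by
  ext ω
  show f (-e j +ᵥ (e j +ᵥ ω)) = f ω
  rw [vadd_vadd, neg_add_cancel, zero_vadd]

open UniversalCStarAlgebra

/-- The generators of the crossed product satisfy the relations of the half-space algebra. -/
theorem mk_eq_of_halfSpaceRel {a b : FreeStarAlgebra (Generator Ω d)} (h : HalfSpaceRel Ω d a b) :
    mk (bulkPresentation Ω d) a = mk (bulkPresentation Ω d) b := by
  have hB : ∀ {a b}, BulkRel Ω d a b →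
      mk (bulkPresentation Ω d) a = mk (bulkPresentation Ω d) b := fun h => mk_eq_of_rel h
  have hsU : ∀ j, star (mk (bulkPresentation Ω d) (u Ω j)) * mk _ (u Ω j) = 1 := fun j => by
    rw [← map_star, ← map_mul, hB (.star_mul_self j), map_one]
  have hUs : ∀ j, mk (bulkPresentation Ω d) (u Ω j) * star (mk _ (u Ω j)) = 1 := fun j => by
    rw [← map_star, ← map_mul, hB (.mul_star_self j), map_one]
  have hcov : ∀ f j, mk (bulkPresentation Ω d) (func Ω d f) * mk _ (u Ω j) =
      mk _ (u Ω j) * mk _ (func Ω d (shift (e j) f)) := fun f j => by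
    have := hB (.covariance f (e j))
    rwa [monomial_e, map_mul, map_mul] at this
  have hcov' : ∀ f j, mk (bulkPresentation Ω d) (func Ω d f) * star (mk _ (u Ω j)) =
      star (mk _ (u Ω j)) * mk _ (func Ω d (shift (-e j) f)) := fun f j => by
    have := hcov (shift (-e j) f) j
    rw [shift_shift_neg] at this
    calc _ = (star (mk _ (u Ω j)) * mk _ (u Ω j)) * mk (bulkPresentation Ω d) (func Ω d f) *
          star (mk _ (u Ω j)) := by rw [hsU, one_mul]
      _ = star (mk _ (u Ω j)) * (mk _ (u Ω j) * mk _ (func Ω d f)) * star (mk _ (u Ω j)) := by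
          simp only [mul_assoc]
      _ = star (mk _ (u Ω j)) * mk _ (func Ω d (shift (-e j) f)) *
          (mk _ (u Ω j) * star (mk _ (u Ω j))) := by rw [← this]; simp only [mul_assoc]
      _ = _ := by rw [hUs, mul_one]
  cases h with
  | function h => exact hB (.function h)
  | star_mul_self j => exact hB (.star_mul_self _)
  | mul_star_self j => exact hB (.mul_star_self _)
  | comm i j => exact hB (.comm _ _)
  | isometry => exact hB (.star_mul_self _)
  | comm_last j => exact hB (.comm _ _)
  | comm_projection f =>
    have : mk (bulkPresentation Ω d) (formalBoundaryProjection : FreeStarAlgebra _) = 0 := by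
      rw [formalBoundaryProjection, map_sub, map_mul, map_star, hUs, map_one, sub_self]
    rw [map_mul, map_mul, this, mul_zero, zero_mul]
  | covariance f j => rw [map_mul, map_mul]; exact hcov f j
  | covariance_star f j => rw [map_mul, map_mul, map_star]; exact hcov' f j

variable (Ω d) in
/-- The canonical homomorphism from the half-space algebra to the bulk algebra, which sends each
function to itself and `û_j` to `u_j`. -/
noncomputable def ev : HalfSpaceAlgebra Ω d →⋆ₐ[ℂ] BulkAlgebra Ω d :=
  lift (gen (bulkPresentation Ω d))
    (fun a b h => by rw [lift_gen_eq_mk]; exact mk_eq_of_halfSpaceRel h)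
    (fun x => norm_gen_le x)

theorem ev_gen (x : Generator Ω d) :
    ev Ω d (gen (halfSpacePresentation Ω d) x) = gen (bulkPresentation Ω d) x :=
  lift_gen _ _ _ x

variable (Ω d) in
/-- The boundary projection `p̂ = 1 - û_d û_d^*` of the half-space algebra. -/
noncomputable def boundaryProjection : HalfSpaceAlgebra Ω d :=
  mk (halfSpacePresentation Ω d) formalBoundaryProjection

theorem isSelfAdjoint_boundaryProjection : IsSelfAdjoint (boundaryProjection Ω d) := by
  rw [IsSelfAdjoint, boundaryProjection, ← map_star]
  simp [formalBoundaryProjection]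

end Observables

section KTheory

open Matrix

/-- Murray-von Neumann equivalence of projections in matrix algebras, of possibly different
sizes: `p = v^* v` and `q = v v^*`. -/
def MvNEquivalent {A : Type u} [Ring A] [StarRing A] {m n : Type} [Fintype m] [Fintype n]
    (p : Matrix m m A) (q : Matrix n n A) : Prop :=
  ∃ v : Matrix n m A, p = vᴴ * v ∧ q = v * vᴴ

namespace MvNEquivalent

variable {A : Type u} [Ring A] [StarRing A] {m n k l : Type} [Fintype m] [Fintype n] [Fintype k]
  [Fintype l]

theorem symm {p : Matrix m m A} {q : Matrix n n A} (h : MvNEquivalent p q) :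
    MvNEquivalent q p := by
  obtain ⟨v, hp, hq⟩ := h
  exact ⟨vᴴ, by rwa [conjTranspose_conjTranspose], by rwa [conjTranspose_conjTranspose]⟩

theorem trans {p : Matrix m m A} {q : Matrix n n A} {r : Matrix k k A} (hp : IsStarProjection p)
    (hr : IsStarProjection r) (h : MvNEquivalent p q) (h' : MvNEquivalent q r) :
    MvNEquivalent p r := by
  obtain ⟨v, h1, h2⟩ := h
  obtain ⟨w, h3, h4⟩ := h'
  refine ⟨w * v, ?_, ?_⟩
  · calc p = p * p := hp.isIdempotentElem.symm
      _ = vᴴ * (v * vᴴ) * v := by rw [h1]; simp only [Matrix.mul_assoc]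
      _ = vᴴ * (wᴴ * w) * v := by rw [← h2, h3]
      _ = (w * v)ᴴ * (w * v) := by rw [conjTranspose_mul]; simp only [Matrix.mul_assoc]
  · calc r = r * r := hr.isIdempotentElem.symm
      _ = w * (wᴴ * w) * wᴴ := by rw [h4]; simp only [Matrix.mul_assoc]
      _ = w * (v * vᴴ) * wᴴ := by rw [← h3, h2]
      _ = (w * v) * (w * v)ᴴ := by rw [conjTranspose_mul]; simp only [Matrix.mul_assoc]

theorem reindex {p : Matrix m m A} (hp : IsStarProjection p) (f : n ≃ m) :
    MvNEquivalent p (p.submatrix f f) := by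
  have h1 : pᴴ = p := hp.isSelfAdjoint
  have h2 : p * p = p := hp.isIdempotentElem
  refine ⟨p.submatrix f id, ?_, ?_⟩
  · rw [conjTranspose_submatrix, submatrix_mul_equiv, h1, h2, submatrix_id_id]
  · rw [conjTranspose_submatrix, h1, ← submatrix_mul p p f id f Function.bijective_id, h2]

theorem refl {p : Matrix m m A} (hp : IsStarProjection p) : MvNEquivalent p p :=
  reindex hp (Equiv.refl m)

theorem fromBlocks {p : Matrix m m A} {p' : Matrix n n A} {q : Matrix k k A} {q' : Matrix l l A}
    (h : MvNEquivalent p p') (h' : MvNEquivalent q q') :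
    MvNEquivalent (Matrix.fromBlocks p 0 0 q) (Matrix.fromBlocks p' 0 0 q') := by
  obtain ⟨v, h1, h2⟩ := h
  obtain ⟨w, h3, h4⟩ := h'
  refine ⟨Matrix.fromBlocks v 0 0 w, ?_, ?_⟩
  · rw [fromBlocks_conjTranspose, fromBlocks_multiply]
    simp [h1, h3]
  · rw [fromBlocks_conjTranspose, fromBlocks_multiply]
    simp [h2, h4]

end MvNEquivalent

theorem isStarProjection_fromBlocks {A : Type u} [Ring A] [StarRing A] {m n : Type} [Fintype m]
    [Fintype n] {p : Matrix m m A} {q : Matrix n n A} (hp : IsStarProjection p)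
    (hq : IsStarProjection q) : IsStarProjection (fromBlocks p 0 0 q) := by
  constructor
  · rw [IsIdempotentElem, fromBlocks_multiply]
    simp [hp.isIdempotentElem.eq, hq.isIdempotentElem.eq]
  · have h1 : pᴴ = p := hp.isSelfAdjoint
    have h2 : qᴴ = q := hq.isSelfAdjoint
    rw [IsSelfAdjoint, star_eq_conjTranspose, fromBlocks_conjTranspose]
    simp [h1, h2]

theorem isStarProjection_submatrix {A : Type u} [Ring A] [StarRing A] {m n : Type} [Fintype m]
    [Fintype n] {p : Matrix m m A} (hp : IsStarProjection p) (f : n ≃ m) :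
    IsStarProjection (p.submatrix f f) := by
  constructor
  · rw [IsIdempotentElem, submatrix_mul_equiv, hp.isIdempotentElem.eq]
  · have h1 : pᴴ = p := hp.isSelfAdjoint
    rw [IsSelfAdjoint, star_eq_conjTranspose, conjTranspose_submatrix, h1]

/-- A projection in some matrix algebra `M_n(A)`. -/
structure MatrixProjection (A : Type u) [Ring A] [StarRing A] where
  size : ℕ
  val : Matrix (Fin size) (Fin size) A
  isStarProjection : IsStarProjection val

namespace MatrixProjection

variable {A : Type u} [Ring A] [StarRing A]

instance setoid : Setoid (MatrixProjection A) where
  r p q := MvNEquivalent p.val q.val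
  iseqv := ⟨fun p => .refl p.isStarProjection, fun h => h.symm,
    fun {p _ r} h h' => h.trans p.isStarProjection r.isStarProjection h'⟩

/-- The block diagonal sum `p ⊕ q`. -/
def directSum (p q : MatrixProjection A) : MatrixProjection A where
  size := p.size + q.size
  val := (fromBlocks p.val 0 0 q.val).submatrix finSumFinEquiv.symm finSumFinEquiv.symm
  isStarProjection := isStarProjection_submatrix
    (isStarProjection_fromBlocks p.isStarProjection q.isStarProjection) _

theorem fromBlocks_equivalent_directSum (p q : MatrixProjection A) :
    MvNEquivalent (fromBlocks p.val 0 0 q.val) (p.directSum q).val :=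
  .reindex (isStarProjection_fromBlocks p.isStarProjection q.isStarProjection) _

theorem directSum_equivalent {p p' q q' : MatrixProjection A} (hp : p ≈ p') (hq : q ≈ q') :
    p.directSum q ≈ p'.directSum q' :=
  ((fromBlocks_equivalent_directSum p q).symm.trans (p.directSum q).isStarProjection
    (isStarProjection_fromBlocks p'.isStarProjection q'.isStarProjection)
      (MvNEquivalent.fromBlocks hp hq)).trans (p.directSum q).isStarProjection
        (p'.directSum q').isStarProjection (fromBlocks_equivalent_directSum p' q')

/-- The unit of `M_n(A)`. -/
def one (A : Type u) [Ring A] [StarRing A] (n : ℕ) : MatrixProjection A where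
  size := n
  val := 1
  isStarProjection := .one _

theorem directSum_comm (p q : MatrixProjection A) : p.directSum q ≈ q.directSum p := by
  have hpq := isStarProjection_fromBlocks p.isStarProjection q.isStarProjection
  have hqp := isStarProjection_fromBlocks q.isStarProjection p.isStarProjection
  have h : MvNEquivalent (fromBlocks p.val 0 0 q.val) (fromBlocks q.val 0 0 p.val) := by
    have := MvNEquivalent.reindex hpq (Equiv.sumComm _ _)
    rwa [show (fromBlocks p.val 0 0 q.val).submatrix (Equiv.sumComm _ _) (Equiv.sumComm _ _) =
      fromBlocks q.val 0 0 p.val from by ext (i | i) (j | j) <;> rfl] at this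
  exact ((fromBlocks_equivalent_directSum p q).symm.trans (p.directSum q).isStarProjection hqp
    h).trans (p.directSum q).isStarProjection (q.directSum p).isStarProjection
      (fromBlocks_equivalent_directSum q p)

theorem one_zero_directSum (p : MatrixProjection A) : (one A 0).directSum p ≈ p := by
  have h0 := isStarProjection_fromBlocks (one A 0).isStarProjection p.isStarProjection
  have h : MvNEquivalent (fromBlocks (one A 0).val 0 0 p.val) p.val := by
    exact MvNEquivalent.reindex h0 (Equiv.emptySum (Fin 0) (Fin p.size)).symm
  exact (fromBlocks_equivalent_directSum _ p).symm.trans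
    ((one A 0).directSum p).isStarProjection p.isStarProjection h

theorem directSum_assoc (p q r : MatrixProjection A) :
    (p.directSum q).directSum r ≈ p.directSum (q.directSum r) := by
  have h1 := isStarProjection_fromBlocks
    (isStarProjection_fromBlocks p.isStarProjection q.isStarProjection) r.isStarProjection
  have h2 := isStarProjection_fromBlocks p.isStarProjection
    (isStarProjection_fromBlocks q.isStarProjection r.isStarProjection)
  have h : MvNEquivalent (fromBlocks (fromBlocks p.val 0 0 q.val) 0 0 r.val)
      (fromBlocks p.val 0 0 (fromBlocks q.val 0 0 r.val)) := by
    have := MvNEquivalent.reindex h1 (Equiv.sumAssoc _ _ _).symm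
    rwa [show (fromBlocks (fromBlocks p.val 0 0 q.val) 0 0 r.val).submatrix
      (Equiv.sumAssoc _ _ _).symm (Equiv.sumAssoc _ _ _).symm =
      fromBlocks p.val 0 0 (fromBlocks q.val 0 0 r.val) from by
        ext (i | i | i) (j | j | j) <;> rfl] at this
  have hl : MvNEquivalent ((p.directSum q).directSum r).val
      (fromBlocks (fromBlocks p.val 0 0 q.val) 0 0 r.val) :=
    (fromBlocks_equivalent_directSum _ r).symm.trans
      ((p.directSum q).directSum r).isStarProjection h1
      (MvNEquivalent.fromBlocks (fromBlocks_equivalent_directSum p q).symm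
        (.refl r.isStarProjection))
  have hr : MvNEquivalent (fromBlocks p.val 0 0 (fromBlocks q.val 0 0 r.val))
      (p.directSum (q.directSum r)).val :=
    (MvNEquivalent.fromBlocks (.refl p.isStarProjection)
      (fromBlocks_equivalent_directSum q r)).trans h2
      (p.directSum (q.directSum r)).isStarProjection (fromBlocks_equivalent_directSum p _)
  exact (hl.trans ((p.directSum q).directSum r).isStarProjection h2 h).trans
    ((p.directSum q).directSum r).isStarProjection
    (p.directSum (q.directSum r)).isStarProjection hr

end MatrixProjection

/-- The semigroup of Murray-von Neumann classes of projections in matrices over `A`. -/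
def ProjectionClass (A : Type u) [Ring A] [StarRing A] : Type u :=
  Quotient (MatrixProjection.setoid (A := A))

instance (A : Type u) [Ring A] [StarRing A] : Add (ProjectionClass A) where
  add := Quotient.map₂ MatrixProjection.directSum
    fun _ _ hp _ _ hq => MatrixProjection.directSum_equivalent hp hq

instance (A : Type u) [Ring A] [StarRing A] : Zero (ProjectionClass A) where
  zero := Quotient.mk _ (MatrixProjection.one A 0)

instance (A : Type u) [Ring A] [StarRing A] : AddCommMonoid (ProjectionClass A) where
  add_assoc := by
    rintro ⟨p⟩ ⟨q⟩ ⟨r⟩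
    exact Quotient.sound (MatrixProjection.directSum_assoc p q r)
  zero_add := by
    rintro ⟨p⟩
    exact Quotient.sound (MatrixProjection.one_zero_directSum p)
  add_zero := by
    rintro ⟨p⟩
    exact Quotient.sound (Setoid.trans (MatrixProjection.directSum_comm p _)
      (MatrixProjection.one_zero_directSum p))
  add_comm := by
    rintro ⟨p⟩ ⟨q⟩
    exact Quotient.sound (MatrixProjection.directSum_comm p q)
  nsmul := nsmulRec

/-- The group `K_0(A)` of a unital `C*`-algebra. -/
abbrev K0 (A : Type u) [CStarAlgebra A] : Type u :=
  Algebra.GrothendieckAddGroup (ProjectionClass A)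

/-- The class `[p]_0` in `K_0(A)`. -/
noncomputable def K0.mk {A : Type u} [CStarAlgebra A] (p : MatrixProjection A) : K0 A :=
  Algebra.GrothendieckAddGroup.of (Quotient.mk MatrixProjection.setoid p : ProjectionClass A)

/-- A unitary in some matrix algebra `M_n(U)`. -/
structure MatrixUnitary (U : Type u) [Ring U] [StarRing U] where
  size : ℕ
  val : unitary (Matrix (Fin size) (Fin size) U)

namespace MatrixUnitary

variable {U : Type u} [Ring U] [StarRing U]

/-- The block diagonal matrix `v ⊕ 1` of size `k ≥ n`. -/
def padMatrix {n k : ℕ} (h : n ≤ k) (v : Matrix (Fin n) (Fin n) U) : Matrix (Fin k) (Fin k) U :=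
  let f : Fin n ⊕ Fin (k - n) ≃ Fin k := finSumFinEquiv.trans (finCongr (Nat.add_sub_cancel' h))
  (fromBlocks v 0 0 1).submatrix f.symm f.symm

theorem padMatrix_mul {n k : ℕ} (h : n ≤ k) (v w : Matrix (Fin n) (Fin n) U) :
    padMatrix h (v * w) = padMatrix h v * padMatrix h w := by
  simp only [padMatrix]
  rw [submatrix_mul_equiv, fromBlocks_multiply]
  simp

theorem padMatrix_star {n k : ℕ} (h : n ≤ k) (v : Matrix (Fin n) (Fin n) U) :
    padMatrix h (star v) = star (padMatrix h v) := by
  simp only [padMatrix]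
  rw [star_eq_conjTranspose, star_eq_conjTranspose, conjTranspose_submatrix,
    fromBlocks_conjTranspose]
  simp

theorem padMatrix_one {n k : ℕ} (h : n ≤ k) :
    padMatrix h (1 : Matrix (Fin n) (Fin n) U) = 1 := by
  simp only [padMatrix]
  rw [fromBlocks_one, submatrix_one_equiv]

theorem padMatrix_apply {n k : ℕ} (h : n ≤ k) (v : Matrix (Fin n) (Fin n) U) (i j : Fin k) :
    padMatrix h v i j = if hi : (i : ℕ) < n then
      (if hj : (j : ℕ) < n then v ⟨i, hi⟩ ⟨j, hj⟩ else 0) else (if i = j then 1 else 0) := by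
  let f : Fin n ⊕ Fin (k - n) ≃ Fin k := finSumFinEquiv.trans (finCongr (Nat.add_sub_cancel' h))
  obtain ⟨i, rfl⟩ := f.surjective i
  obtain ⟨j, rfl⟩ := f.surjective j
  have hl : ∀ a : Fin n, ((f (Sum.inl a) : Fin k) : ℕ) = a := fun a => by simp [f]
  have hr : ∀ a : Fin (k - n), ((f (Sum.inr a) : Fin k) : ℕ) = n + a := fun a => by simp [f]
  have : padMatrix h v (f i) (f j) = fromBlocks v 0 0 1 i j := by
    show fromBlocks v 0 0 1 (f.symm (f i)) (f.symm (f j)) = _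
    simp
  rw [this]
  rcases i with i | i <;> rcases j with j | j
  · simp [hl]
  · simp [hl, hr]
  · have : f (Sum.inr i) ≠ f (Sum.inl j) := fun h => by simpa using f.injective h
    simp [hr, this]
  · by_cases hij : i = j
    · subst hij; simp [hr]
    · have : f (Sum.inr i) ≠ f (Sum.inr j) := fun h => hij (by simpa using f.injective h)
      simp [hr, this, hij]

/-- The unitary `v ⊕ 1` of size `k ≥ n`. -/
def pad {n k : ℕ} (h : n ≤ k) (v : unitary (Matrix (Fin n) (Fin n) U)) :
    unitary (Matrix (Fin k) (Fin k) U) :=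
  ⟨padMatrix h v, by
    obtain ⟨h1, h2⟩ := Unitary.mem_iff.1 v.2
    rw [Unitary.mem_iff, ← padMatrix_star, ← padMatrix_mul, ← padMatrix_mul, h1, h2,
      padMatrix_one]
    exact ⟨rfl, rfl⟩⟩

theorem pad_pad {n k l : ℕ} (h : n ≤ k) (h' : k ≤ l) (v : unitary (Matrix (Fin n) (Fin n) U)) :
    pad h' (pad h v) = pad (h.trans h') v := by
  refine Subtype.ext (Matrix.ext fun i j => ?_)
  show padMatrix h' (padMatrix h v.1) i j = padMatrix (h.trans h') v.1 i j
  simp only [padMatrix_apply]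
  by_cases hi : (i : ℕ) < n
  · have hi' : (i : ℕ) < k := by omega
    by_cases hj : (j : ℕ) < n
    · have hj' : (j : ℕ) < k := by omega
      simp [hi, hi', hj, hj']
    · simp [hi, hi', hj]
  · by_cases hi' : (i : ℕ) < k
    · by_cases hj' : (j : ℕ) < k
      · simp [hi, hi', hj', Fin.ext_iff]
      · have : i ≠ j := fun h => hj' (h ▸ hi')
        simp [hi, hi', hj', this]
    · simp [hi, hi']

variable [TopologicalSpace U]

theorem continuous_pad {n k : ℕ} (h : n ≤ k) : Continuous (pad (U := U) h) := by
  refine Continuous.subtype_mk ?_ _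
  refine continuous_matrix fun i j => ?_
  simp only [padMatrix_apply]
  split_ifs
  · exact (continuous_subtype_val).matrix_elem _ _
  · exact continuous_const
  · exact continuous_const
  · exact continuous_const

/-- Stable homotopy: `v ⊕ 1` and `w ⊕ 1` are joined by a path of unitary matrices of some common
size. -/
def Homotopic (v w : MatrixUnitary U) : Prop :=
  ∃ (k : ℕ) (hv : v.size ≤ k) (hw : w.size ≤ k), Joined (pad hv v.val) (pad hw w.val)

theorem joined_pad {n k : ℕ} (h : n ≤ k) {v w : unitary (Matrix (Fin n) (Fin n) U)}
    (hvw : Joined v w) : Joined (pad h v) (pad h w) :=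
  ⟨hvw.somePath.map (continuous_pad h)⟩

theorem equivalence : Equivalence (Homotopic (U := U)) where
  refl v := ⟨v.size, le_rfl, le_rfl, Joined.refl _⟩
  symm := fun ⟨k, hv, hw, h⟩ => ⟨k, hw, hv, h.symm⟩
  trans := by
    rintro v w x ⟨k, hv, hw, h⟩ ⟨l, hw', hx, h'⟩
    refine ⟨max k l, hv.trans (le_max_left _ _), hx.trans (le_max_right _ _), ?_⟩
    have h1 := joined_pad (le_max_left k l) h
    have h2 := joined_pad (le_max_right k l) h'
    rw [pad_pad, pad_pad] at h1 h2
    exact h1.trans h2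

instance setoid : Setoid (MatrixUnitary U) := ⟨Homotopic, equivalence⟩

end MatrixUnitary

/-- The group `K_1(J)` of a (possibly non-unital) `C*`-algebra, as the set of stable homotopy
classes of unitary matrices over the algebra with an adjoined unit. -/
noncomputable def K1 (J : Type u) [NonUnitalCStarAlgebra J] : Type u :=
  Quotient (MatrixUnitary.setoid (U := Unitization ℂ J))

/-- The class `[v]_1` in `K_1(J)`. -/
noncomputable def K1.mk {J : Type u} [NonUnitalCStarAlgebra J] {n : ℕ}
    (v : unitary (Matrix (Fin n) (Fin n) (Unitization ℂ J))) : K1 J :=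
  Quotient.mk MatrixUnitary.setoid ⟨n, v⟩

/-- The class of the adjoined identity, the neutral element of `K_1(J)`. -/
noncomputable instance (J : Type u) [NonUnitalCStarAlgebra J] : One (K1 J) where
  one := K1.mk (1 : unitary (Matrix (Fin 1) (Fin 1) (Unitization ℂ J)))

end KTheory

section Ideal

variable {B : Type u} [CStarAlgebra B]

/-- The linear span of the products `a p b`, a `*`-invariant two-sided ideal for self-adjoint `p`. -/
noncomputable def algebraicIdeal (p : B) (hp : IsSelfAdjoint p) : NonUnitalStarSubalgebra ℂ B where
  __ := Submodule.span ℂ {x : B | ∃ a b, x = a * p * b}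
  mul_mem' {x y} hx hy := by
    change x ∈ Submodule.span ℂ _ at hx
    change x * y ∈ Submodule.span ℂ _
    induction hx using Submodule.span_induction with
    | mem x h =>
      obtain ⟨a, b, rfl⟩ := h
      exact Submodule.subset_span ⟨a, b * y, by simp only [mul_assoc]⟩
    | zero => rw [zero_mul]; exact zero_mem _
    | add x z _ _ h1 h2 => rw [add_mul]; exact add_mem h1 h2
    | smul c x _ h => rw [smul_mul_assoc]; exact Submodule.smul_mem _ c h
  star_mem' {x} hx := by
    change x ∈ Submodule.span ℂ _ at hx
    change star x ∈ Submodule.span ℂ _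
    induction hx using Submodule.span_induction with
    | mem x h =>
      obtain ⟨a, b, rfl⟩ := h
      exact Submodule.subset_span ⟨star b, star a, by simp [hp.star_eq, mul_assoc]⟩
    | zero => rw [star_zero]; exact zero_mem _
    | add x z _ _ h1 h2 => rw [star_add]; exact add_mem h1 h2
    | smul c x _ h => rw [star_smul]; exact Submodule.smul_mem _ _ h

/-- The closed two-sided ideal generated by a self-adjoint element. -/
noncomputable def closedIdeal (p : B) (hp : IsSelfAdjoint p) : NonUnitalStarSubalgebra ℂ B :=
  (algebraicIdeal p hp).topologicalClosure

instance (p : B) (hp : IsSelfAdjoint p) : IsClosed (closedIdeal p hp : Set B) :=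
  NonUnitalStarSubalgebra.isClosed_topologicalClosure _

end Ideal

section ExponentialMap

variable {A B : Type u} [CStarAlgebra A] [CStarAlgebra B] [PartialOrder B] [StarOrderedRing B]

/-- The unital `*`-homomorphism from the unitization of a subalgebra of `B` to `B` that extends
the inclusion. -/
noncomputable def unitizationInclusion (J : NonUnitalStarSubalgebra ℂ B) :
    Unitization ℂ J →⋆ₐ[ℂ] B :=
  Unitization.starLift (NonUnitalStarSubalgebraClass.subtype J)

/-- The graph of the exponential map `K_0(A) → K_1(J)` of an extension `0 → J → B → A → 0` with
`B` and `A` unital: if `p` is a projection in `M_n(A)` and the self-adjoint matrix `a` in `M_n(B)`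
is a lift of `p`, then `[p]_0 - [1_k]_0` is mapped to `[exp(2πi a)]_1`, where `exp(2πi a)` is
regarded as a unitary matrix `v` over `J` with an adjoined unit. -/
def IsExponential (π : B →⋆ₐ[ℂ] A) (J : NonUnitalStarSubalgebra ℂ B) [IsClosed (J : Set B)]
    (x : K0 A) (y : K1 J) : Prop :=
  ∃ (p : MatrixProjection A) (k : ℕ) (a : CStarMatrix (Fin p.size) (Fin p.size) B)
    (v : unitary (Matrix (Fin p.size) (Fin p.size) (Unitization ℂ J))),
    x = K0.mk p - K0.mk (MatrixProjection.one A k) ∧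
    y = K1.mk v ∧
    IsSelfAdjoint a ∧
    (∀ i j, π (a i j) = p.val i j) ∧
    ∀ i j, unitizationInclusion J ((v : Matrix _ _ _) i j) =
      NormedSpace.exp ((2 * Real.pi * Complex.I : ℂ) • a) i j

open Classical in
/-- The exponential map `K_0(A) → K_1(J)` of the extension `0 → J → B → A → 0`. For an exact
sequence each element of `K_0(A)` has exactly one exponential; in the absence of an exponential the
value is the neutral element. -/
noncomputable def exponentialMap (π : B →⋆ₐ[ℂ] A) (J : NonUnitalStarSubalgebra ℂ B)
    [IsClosed (J : Set B)] (x : K0 A) : K1 J :=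
  if h : ∃ y, IsExponential π J x y then h.choose else 1

end ExponentialMap

section Spectrum

variable {A : Type u} [CStarAlgebra A]

/-- A spectral gap of a self-adjoint element: a connected component of the complement of its
spectrum in `ℝ`. -/
def IsSpectralGap (h : A) (G : Set ℝ) : Prop :=
  ∃ x ∈ (spectrum ℝ h)ᶜ, G = connectedComponentIn (spectrum ℝ h)ᶜ x

/-- The spectral projection `p_G = χ(h ≤ G)` onto the part of the spectrum below `G`. -/
noncomputable def gapProjection (h : A) (G : Set ℝ) : A :=
  cfc (Set.indicator (lowerBounds G) (1 : ℝ → ℝ)) h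

theorem isStarProjection_gapProjection (h : A) (G : Set ℝ) :
    IsStarProjection (gapProjection h G) := by
  refine ⟨?_, cfc_predicate _ h⟩
  rw [IsIdempotentElem, gapProjection]
  by_cases hc : ContinuousOn (Set.indicator (lowerBounds G) (1 : ℝ → ℝ)) (spectrum ℝ h)
  · rw [← cfc_mul _ _ h hc hc]
    congr 1
    funext x
    by_cases hx : x ∈ lowerBounds G <;> simp [hx]
  · rw [cfc_apply_of_not_continuousOn h hc, mul_zero]

end Spectrum

section HalfSpace

variable (Ω : Type u) [TopologicalSpace Ω] [CompactSpace Ω] (d : ℕ)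
  [AddAction (Fin (d + 1) → ℤ) Ω] [ContinuousConstVAdd (Fin (d + 1) → ℤ) Ω]

/-- The algebra of boundary observables: the closed two-sided ideal of the half-space algebra
generated by `p̂`. -/
noncomputable def boundaryAlgebra : NonUnitalStarSubalgebra ℂ (HalfSpaceAlgebra Ω d) :=
  closedIdeal (boundaryProjection Ω d) isSelfAdjoint_boundaryProjection

instance : IsClosed (boundaryAlgebra Ω d : Set (HalfSpaceAlgebra Ω d)) :=
  inferInstanceAs (IsClosed (closedIdeal (boundaryProjection Ω d) _ : Set (HalfSpaceAlgebra Ω d)))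

/-- The exponential map of `0 → Ã → Â → A → 0`, where `Ã`, `Â` and `A` are the boundary, half-space
and bulk algebras. -/
noncomputable def Exp : K0 (BulkAlgebra Ω d) → K1 (boundaryAlgebra Ω d) :=
  exponentialMap (ev Ω d) (boundaryAlgebra Ω d)

variable {Ω d} {N : ℕ}

/-- The class `[p_G]_0` in `K_0` of the bulk algebra. -/
noncomputable def gapClass (h : CStarMatrix (Fin N) (Fin N) (BulkAlgebra Ω d)) (G : Set ℝ) :
    K0 (BulkAlgebra Ω d) :=
  K0.mk ⟨N, CStarMatrix.ofMatrix.symm (gapProjection h G),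
    (isStarProjection_gapProjection h G).isIdempotentElem,
    (isStarProjection_gapProjection h G).isSelfAdjoint⟩

/-- The boundary spectrum `Spec(ĥ) \ Spec(ev(ĥ))`. -/
noncomputable def boundarySpectrum (hhat : CStarMatrix (Fin N) (Fin N) (HalfSpaceAlgebra Ω d)) :
    Set ℝ :=
  spectrum ℝ hhat \ spectrum ℝ (hhat.map (ev Ω d))

end HalfSpace

end BulkBoundary

/-!
Suppose that a point `x` of the gap `G` is not in the spectrum of the half-space operator `hhat`.
The function `χ(· ≤ x)` is then continuous on `Spec(hhat)`, and `χ(hhat ≤ x)` is a projection over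
the half-space algebra. Applying `ev` gives `χ(h ≤ x)`, which is the gap projection `p_G`, because
`h` has no spectrum in `G`. So `p_G` lifts to a projection `P`, and `exp(2πi P) = 1` says that its
exponential is trivial (`Exp_gapClass_eq_one_of_notMem_spectrum`). The assumption on `p_G` excludes
this, and every point of `G` is boundary spectrum.

The value of the exponential map may be computed from another representative `[p]_0 - [1_k]_0` of
the class and another self-adjoint lift `a` of `p`, so it has to be shown that `[exp(2πi a)]_1` is
trivial whatever the choices are (`eq_one_of_isExponential_of_lift`).

* By equality in `K_0`, the projections `p ⊕ 1` and `p_G ⊕ 1 ⊕ 1` are Murray-von Neumann equivalent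
  for suitable sizes of the units (`exists_directSum_one_equivalent_of_K0_eq`). The second of them
  lifts to a projection.
* Equivalent projections become conjugate, after adding zero blocks, by a self-adjoint unitary,
  which is an exponential and lifts to a unitary. Hence `p ⊕ 1 ⊕ 0` lifts to a projection `R`
  (`exists_projection_lift_of_MvNEquivalent`).
* Along the segment from `a ⊕ 1 ⊕ 0` to `R` the image over the bulk algebra stays constant, so
  `exp(2πi ·)` is a path of unitaries that are `1` modulo the boundary algebra. It joins
  `exp(2πi a) ⊕ 1` to `1` (`joined_one_of_projection_lift`).

The path has to be read over the unitization of the boundary algebra `J`, which maps into the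
half-space algebra injectively only when `1 ∉ J`. In the case `1 ∈ J` the image does not determine
the scalar part, but all scalar parts are joined, as the unitary group of `M_n(ℂ)` is connected
(`joined_of_matrixMap_unitizationInclusion_eq`).

The argument uses that `ev` is onto with kernel the boundary algebra (`ev_surjective`,
`ev_eq_zero_iff`). The relations of the bulk algebra hold modulo the boundary algebra, and the
quotient norm satisfies the `C*`-identity (`norm_quotient_star_mul_self`). The quotient norm is
therefore at most the universal norm of the bulk algebra (`norm_mkQ_boundaryAlgebra_le`). So an
element of the kernel has quotient norm zero, and the image of `ev` is closed.
-/

namespace BulkBoundary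

/-! ### The quotient norm of a `C*`-algebra by a two-sided ideal -/

section QuotientNorm

variable {B : Type u} [CStarAlgebra B]

/-- An element of an ideal has an approximate right unit in the ideal: for `a = j^* j` and small
`δ`, the element `e = a (a + δ)⁻¹ = 1 - δ (a + δ)⁻¹`. -/
theorem exists_mem_norm_mul_one_sub_le (S : Submodule ℂ B) (hl : ∀ b, ∀ x ∈ S, b * x ∈ S)
    (hr : ∀ b, ∀ x ∈ S, x * b ∈ S) {j : B} (hj : j ∈ S) {ε : ℝ} (hε : 0 < ε) :
    ∃ e ∈ S, ‖1 - e‖ ≤ 1 ∧ ‖j * (1 - e)‖ ≤ ε := by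
  set a := star j * j with ha
  have haS : a ∈ S := hl _ _ hj
  have hsa : IsSelfAdjoint a := IsSelfAdjoint.star_mul_self j
  have hpos : ∀ t ∈ spectrum ℝ a, 0 ≤ t := fun t ht => spectrum_star_mul_self_nonneg t ht
  have hδ : 0 < ε ^ 2 := by positivity
  set δ := ε ^ 2
  have hne : ∀ t ∈ spectrum ℝ a, t + δ ≠ 0 := fun t ht =>
    (add_pos_of_nonneg_of_pos (hpos t ht) hδ).ne'
  have hc1 : ContinuousOn (fun t : ℝ => (t + δ)⁻¹) (spectrum ℝ a) :=
    (continuousOn_id.add continuousOn_const).inv₀ hne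
  have hc2 : ContinuousOn (fun t : ℝ => δ * (t + δ)⁻¹) (spectrum ℝ a) := continuousOn_const.mul hc1
  set c := cfc (fun t : ℝ => δ * (t + δ)⁻¹) a with hc
  have hcsa : IsSelfAdjoint c := cfc_predicate _ a
  have hce : a * cfc (fun t : ℝ => (t + δ)⁻¹) a = 1 - c := by
    conv_lhs => rw [← cfc_id' ℝ a]
    rw [hc, ← cfc_one ℝ a, ← cfc_sub _ _ a (by fun_prop) hc2]
    conv_lhs => rw [cfc_id' ℝ a]
    conv_lhs => enter [1]; rw [← cfc_id' ℝ a]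
    rw [← cfc_mul _ _ a (by fun_prop) hc1]
    refine cfc_congr fun t ht => ?_
    have := hne t ht
    simp only [Pi.one_apply]
    field_simp
    ring
  refine ⟨1 - c, hce ▸ hr _ _ haS, ?_, ?_⟩
  · rw [sub_sub_cancel]
    refine norm_cfc_le zero_le_one fun t ht => ?_
    have h1 := hpos t ht
    rw [Real.norm_of_nonneg (by positivity), ← div_eq_mul_inv]
    exact div_le_one_of_le₀ (by linarith) (by linarith)
  · rw [sub_sub_cancel]
    have h2 : star (j * c) * (j * c) =
        cfc (fun t : ℝ => δ * (t + δ)⁻¹ * t * (δ * (t + δ)⁻¹)) a := by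
      have hc3 : ContinuousOn (fun t : ℝ => t) (spectrum ℝ a) := continuousOn_id
      have hc4 : ContinuousOn (fun t : ℝ => δ * (t + δ)⁻¹ * t) (spectrum ℝ a) := hc2.mul hc3
      rw [cfc_mul _ _ a hc4 hc2, cfc_mul _ _ a hc2 hc3, cfc_id' ℝ a, star_mul, hcsa.star_eq, ← hc,
        ha]
      simp only [mul_assoc]
    have h3 : ‖star (j * c) * (j * c)‖ ≤ δ := by
      rw [h2]
      refine norm_cfc_le hδ.le fun t ht => ?_
      have h1 := hpos t ht
      have h4 : 0 < t + δ := by positivity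
      rw [Real.norm_of_nonneg (by positivity)]
      have e1 : δ * (t + δ)⁻¹ * t * (δ * (t + δ)⁻¹) =
          δ * ((t * (t + δ)⁻¹) * (δ * (t + δ)⁻¹)) := by ring
      rw [e1]
      refine mul_le_of_le_one_right hδ.le (mul_le_one₀ ?_ (by positivity) ?_)
      · rw [← div_eq_mul_inv]; exact div_le_one_of_le₀ (by linarith) h4.le
      · rw [← div_eq_mul_inv]; exact div_le_one_of_le₀ (by linarith) h4.le
    rw [CStarRing.norm_star_mul_self, ← sq] at h3
    exact le_of_sq_le_sq h3 hε.le

theorem norm_quotient_mul_le (S : Submodule ℂ B) (hl : ∀ b, ∀ x ∈ S, b * x ∈ S)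
    (hr : ∀ b, ∀ x ∈ S, x * b ∈ S) (a b : B) :
    ‖S.mkQ (a * b)‖ ≤ ‖S.mkQ a‖ * ‖S.mkQ b‖ := by
  refine le_of_forall_pos_le_add fun ε hε => ?_
  have hcont : Filter.Tendsto (fun δ : ℝ => (‖S.mkQ a‖ + δ) * (‖S.mkQ b‖ + δ))
      (nhdsWithin 0 (Set.Ioi 0)) (nhds ((‖S.mkQ a‖ + 0) * (‖S.mkQ b‖ + 0))) :=
    (Continuous.tendsto (by fun_prop) 0).mono_left nhdsWithin_le_nhds
  rw [add_zero, add_zero] at hcont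
  refine le_trans ?_ (le_add_of_nonneg_right hε.le)
  refine ge_of_tendsto hcont (Filter.eventually_of_mem self_mem_nhdsWithin fun δ hδ => ?_)
  obtain ⟨a', ha', hna⟩ := Submodule.Quotient.norm_mk_lt (S.mkQ a) hδ
  obtain ⟨b', hb', hnb⟩ := Submodule.Quotient.norm_mk_lt (S.mkQ b) hδ
  have h1 : a' - a ∈ S := (Submodule.Quotient.eq S).1 ha'
  have h2 : b' - b ∈ S := (Submodule.Quotient.eq S).1 hb'
  have h3 : S.mkQ (a * b) = S.mkQ (a' * b') := by
    rw [eq_comm]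
    refine (Submodule.Quotient.eq S).2 ?_
    have : a' * b' - a * b = (a' - a) * b' + a * (b' - b) := by noncomm_ring
    rw [this]
    exact S.add_mem (hr _ _ h1) (hl _ _ h2)
  rw [h3]
  refine (Submodule.Quotient.norm_mk_le S (a' * b')).trans ((norm_mul_le _ _).trans ?_)
  exact mul_le_mul hna.le hnb.le (norm_nonneg _) ((norm_nonneg a').trans hna.le)

theorem norm_quotient_star_le (S : Submodule ℂ B) (hs : ∀ x ∈ S, star x ∈ S) (a : B) :
    ‖S.mkQ (star a)‖ ≤ ‖S.mkQ a‖ := by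
  refine le_of_forall_pos_le_add fun ε hε => ?_
  obtain ⟨a', ha', hna⟩ := Submodule.Quotient.norm_mk_lt (S.mkQ a) hε
  have h1 : a' - a ∈ S := (Submodule.Quotient.eq S).1 ha'
  have h3 : S.mkQ (star a) = S.mkQ (star a') := by
    rw [eq_comm]
    refine (Submodule.Quotient.eq S).2 ?_
    rw [← star_sub]
    exact hs _ h1
  rw [h3]
  refine (Submodule.Quotient.norm_mk_le S (star a')).trans ?_
  rw [norm_star]
  exact hna.le

/-- The quotient norm by a self-adjoint two-sided ideal satisfies the `C*`-identity. The ideal need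
not be closed. -/
theorem norm_quotient_star_mul_self (S : Submodule ℂ B) (hl : ∀ b, ∀ x ∈ S, b * x ∈ S)
    (hr : ∀ b, ∀ x ∈ S, x * b ∈ S) (hs : ∀ x ∈ S, star x ∈ S) (b : B) :
    ‖S.mkQ (star b * b)‖ = ‖S.mkQ b‖ ^ 2 := by
  refine le_antisymm ?_ ?_
  · refine (norm_quotient_mul_le S hl hr _ _).trans ?_
    rw [sq]
    exact mul_le_mul_of_nonneg_right (norm_quotient_star_le S hs b) (norm_nonneg _)
  · refine le_of_forall_pos_le_add fun ε hε => ?_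
    obtain ⟨x, hx, hnx⟩ := Submodule.Quotient.norm_mk_lt (S.mkQ (star b * b)) (half_pos hε)
    have hj : star b * b - x ∈ S := by
      rw [← neg_sub]; exact S.neg_mem ((Submodule.Quotient.eq S).1 hx)
    -- With an approximate unit `e` for `b^* b - x`, the class of `b` is that of `b (1 - e)`, and
    -- the norm of `b^* b (1 - e)` is up to `ε / 2` at most that of `x`.
    obtain ⟨e, he, h1, h2⟩ := exists_mem_norm_mul_one_sub_le S hl hr hj (half_pos hε)
    have h3 : ‖S.mkQ b‖ ≤ ‖b * (1 - e)‖ := by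
      have : S.mkQ b = S.mkQ (b * (1 - e)) := by
        refine (Submodule.Quotient.eq S).2 ?_
        rw [mul_sub, mul_one, sub_sub_cancel]
        exact hl _ _ he
      rw [this]
      exact Submodule.Quotient.norm_mk_le S _
    calc ‖S.mkQ b‖ ^ 2 ≤ ‖b * (1 - e)‖ ^ 2 := by gcongr
      _ = ‖star (1 - e) * ((star b * b) * (1 - e))‖ := by
          rw [sq, ← CStarRing.norm_star_mul_self, star_mul]; simp only [mul_assoc]
      _ ≤ 1 * ‖(star b * b) * (1 - e)‖ := (norm_mul_le _ _).trans (by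
          gcongr; rw [norm_star]; exact h1)
      _ = ‖x * (1 - e) + (star b * b - x) * (1 - e)‖ := by
          rw [one_mul, ← add_mul, add_sub_cancel]
      _ ≤ ‖x‖ * 1 + ε / 2 := (norm_add_le _ _).trans (add_le_add
          ((norm_mul_le _ _).trans (by gcongr)) h2)
      _ ≤ _ := by linarith

end QuotientNorm

/-! ### The closed ideal generated by an element -/

section Ideal

variable {B : Type u} [CStarAlgebra B] {p : B} {hp : IsSelfAdjoint p}

theorem mul_mem_closedIdeal_left (b : B) {x : B} (hx : x ∈ closedIdeal p hp) :
    b * x ∈ closedIdeal p hp := by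
  have hx' : x ∈ closure (algebraicIdeal p hp : Set B) := hx
  refine map_mem_closure (f := fun y => b * y) (continuous_const.mul continuous_id) hx' ?_
  intro y hy
  change y ∈ Submodule.span ℂ _ at hy
  change b * y ∈ Submodule.span ℂ _
  induction hy using Submodule.span_induction with
  | mem x h =>
    obtain ⟨c, c', rfl⟩ := h
    exact Submodule.subset_span ⟨b * c, c', by simp only [mul_assoc]⟩
  | zero => rw [mul_zero]; exact zero_mem _
  | add x z _ _ h1 h2 => rw [mul_add]; exact add_mem h1 h2
  | smul c x _ h => rw [mul_smul_comm]; exact Submodule.smul_mem _ c h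

theorem mul_mem_closedIdeal_right (b : B) {x : B} (hx : x ∈ closedIdeal p hp) :
    x * b ∈ closedIdeal p hp := by
  rw [← star_star (x * b), star_mul]
  exact star_mem (mul_mem_closedIdeal_left _ (star_mem hx))

theorem self_mem_closedIdeal : p ∈ closedIdeal p hp :=
  subset_closure (Submodule.subset_span ⟨1, 1, by simp⟩ :
    p ∈ (algebraicIdeal p hp : Set B))

end Ideal

/-! ### Exactness of the sequence of boundary, half-space and bulk algebras -/

section Exactness

open UniversalCStarAlgebra

variable {Ω : Type u} [TopologicalSpace Ω] [CompactSpace Ω] {d : ℕ}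
  [AddAction (Fin (d + 1) → ℤ) Ω] [ContinuousConstVAdd (Fin (d + 1) → ℤ) Ω]

theorem shift_zero (f : C(Ω, ℂ)) : shift (0 : Fin (d + 1) → ℤ) f = f := by
  ext ω
  show f ((0 : Fin (d + 1) → ℤ) +ᵥ ω) = f ω
  rw [zero_vadd]

theorem shift_shift (a b : Fin (d + 1) → ℤ) (f : C(Ω, ℂ)) :
    shift b (shift a f) = shift (a + b) f := by
  ext ω
  show f (a +ᵥ (b +ᵥ ω)) = f ((a + b) +ᵥ ω)
  rw [vadd_vadd]

/-- The covariance relation `f x = x (f ∘ τ_n)` for all `f`, in the half-space algebra modulo the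
boundary algebra. -/
def IsCovariantModBoundary (x : FreeStarAlgebra (Generator Ω d)) (n : Fin (d + 1) → ℤ) : Prop :=
  ∀ f : C(Ω, ℂ), mk (halfSpacePresentation Ω d) (func Ω d f * x - x * func Ω d (shift n f)) ∈
    boundaryAlgebra Ω d

namespace IsCovariantModBoundary

variable {x y : FreeStarAlgebra (Generator Ω d)} {a b : Fin (d + 1) → ℤ}

theorem one : IsCovariantModBoundary (1 : FreeStarAlgebra (Generator Ω d)) 0 := fun f => by
  rw [shift_zero, mul_one, one_mul, sub_self, map_zero]
  exact zero_mem _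

theorem mul (hx : IsCovariantModBoundary x a) (hy : IsCovariantModBoundary y b) :
    IsCovariantModBoundary (x * y) (a + b) := fun f => by
  have : func Ω d f * (x * y) - x * y * func Ω d (shift (a + b) f) =
      (func Ω d f * x - x * func Ω d (shift a f)) * y +
      x * (func Ω d (shift a f) * y - y * func Ω d (shift b (shift a f))) := by
    rw [shift_shift]; noncomm_ring
  rw [this, map_add, map_mul, map_mul]
  exact add_mem (mul_mem_closedIdeal_right _ (hx f)) (mul_mem_closedIdeal_left _ (hy _))

theorem pow (hx : IsCovariantModBoundary x a) (k : ℕ) :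
    IsCovariantModBoundary (x ^ k) (k • a) := by
  induction k with
  | zero => rw [pow_zero, zero_smul]; exact one
  | succ k ih => rw [pow_succ, succ_nsmul]; exact ih.mul hx

theorem prod_ofFn {m : ℕ} {x : Fin m → FreeStarAlgebra (Generator Ω d)}
    {a : Fin m → Fin (d + 1) → ℤ} (h : ∀ i, IsCovariantModBoundary (x i) (a i)) :
    IsCovariantModBoundary (List.ofFn x).prod (∑ i, a i) := by
  induction m with
  | zero => simpa using one
  | succ m ih =>
    rw [List.ofFn_succ, List.prod_cons, Fin.sum_univ_succ]
    exact (h 0).mul (ih fun i => h i.succ)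

theorem u (j : Fin (d + 1)) : IsCovariantModBoundary (u Ω j) (e j) := fun f => by
  rw [map_sub, mk_eq_of_rel (HalfSpaceRel.covariance f j), sub_self]
  exact zero_mem _

theorem star_u (j : Fin (d + 1)) : IsCovariantModBoundary (star (BulkBoundary.u Ω j)) (-e j) :=
  fun f => by
    rw [map_sub, mk_eq_of_rel (HalfSpaceRel.covariance_star f j), sub_self]
    exact zero_mem _

theorem unitaryZPow (j : Fin (d + 1)) (k : ℤ) :
    IsCovariantModBoundary (unitaryZPow (BulkBoundary.u Ω j) k) (k • e j) := by
  rcases k with k | k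
  · have := (u (Ω := Ω) j).pow k
    rwa [← natCast_zsmul] at this
  · have := (star_u (Ω := Ω) j).pow (k + 1)
    rw [smul_neg] at this
    rw [negSucc_zsmul]
    exact this

theorem monomial (n : Fin (d + 1) → ℤ) : IsCovariantModBoundary (monomial Ω n) n := by
  have h := prod_ofFn fun j => unitaryZPow (Ω := Ω) j (n j)
  have hn : ∑ j, n j • e j = n := by
    conv_rhs => rw [← Finset.univ_sum_single n]
    refine Finset.sum_congr rfl fun j _ => ?_
    rw [e, ← Pi.single_smul, smul_eq_mul, mul_one]
  rwa [hn] at h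

end IsCovariantModBoundary

/-- The relations of the bulk algebra hold in the half-space algebra modulo the boundary algebra. -/
theorem mk_sub_mem_boundaryAlgebra {a b : FreeStarAlgebra (Generator Ω d)}
    (h : BulkRel Ω d a b) : mk (halfSpacePresentation Ω d) (a - b) ∈ boundaryAlgebra Ω d := by
  have hR : ∀ {a b}, HalfSpaceRel Ω d a b →
      mk (halfSpacePresentation Ω d) (a - b) ∈ boundaryAlgebra Ω d := fun h => by
    rw [map_sub, mk_eq_of_rel h, sub_self]; exact zero_mem _
  have hneg : ∀ {a b : FreeStarAlgebra (Generator Ω d)},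
      mk (halfSpacePresentation Ω d) (a - b) ∈ boundaryAlgebra Ω d →
      mk (halfSpacePresentation Ω d) (b - a) ∈ boundaryAlgebra Ω d := fun h => by
    rw [← neg_sub, map_neg]; exact neg_mem h
  cases h with
  | function h => exact hR (.function h)
  | star_mul_self j =>
    refine Fin.lastCases ?_ (fun j => ?_) j
    · exact hR .isometry
    · exact hR (.star_mul_self j)
  | mul_star_self j =>
    refine Fin.lastCases ?_ (fun j => ?_) j
    · exact hneg self_mem_closedIdeal
    · exact hR (.mul_star_self j)
  | comm i j =>
    refine Fin.lastCases ?_ (fun i => ?_) i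
    · refine Fin.lastCases ?_ (fun j => ?_) j
      · rw [sub_self, map_zero]; exact zero_mem _
      · exact hR (.comm_last j)
    · refine Fin.lastCases ?_ (fun j => ?_) j
      · exact hneg (hR (.comm_last i))
      · exact hR (.comm i j)
  | covariance f n => exact IsCovariantModBoundary.monomial n f

theorem ev_mk (a : FreeStarAlgebra (Generator Ω d)) :
    ev Ω d (mk (halfSpacePresentation Ω d) a) = mk (bulkPresentation Ω d) a := by
  exact (lift_mk _ _ _ a).trans (DFunLike.congr_fun lift_gen_eq_mk a)

theorem ev_boundaryProjection : ev Ω d (boundaryProjection Ω d) = 0 := by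
  rw [boundaryProjection, ev_mk, formalBoundaryProjection, map_sub, sub_eq_zero,
    ← mk_eq_of_rel (BulkRel.mul_star_self (Fin.last d))]

theorem continuous_ev : Continuous (ev Ω d) :=
  map_continuous (ev Ω d)

/-- The quotient seminorm modulo the boundary algebra is admissible for the presentation of the
bulk algebra, hence is dominated by the norm of the bulk algebra. -/
theorem norm_mkQ_boundaryAlgebra_le (b : HalfSpaceAlgebra Ω d) :
    ‖(boundaryAlgebra Ω d).toSubmodule.mkQ b‖ ≤ ‖ev Ω d b‖ := by
  set S : Submodule ℂ (HalfSpaceAlgebra Ω d) := (boundaryAlgebra Ω d).toSubmodule with hS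
  have hl : ∀ b, ∀ x ∈ S, b * x ∈ S := fun b x hx => mul_mem_closedIdeal_left b hx
  have hr : ∀ b, ∀ x ∈ S, x * b ∈ S := fun b x hx => mul_mem_closedIdeal_right b hx
  have hs : ∀ x ∈ S, star x ∈ S := fun x hx =>
    star_mem (S := NonUnitalStarSubalgebra ℂ (HalfSpaceAlgebra Ω d)) (s := boundaryAlgebra Ω d) hx
  let q : Seminorm ℂ (FreeStarAlgebra (Generator Ω d)) :=
    (normSeminorm ℂ (HalfSpaceAlgebra Ω d ⧸ S)).comp
      (S.mkQ ∘ₗ (mk (halfSpacePresentation Ω d)).toAlgHom.toLinearMap)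
  have hq : ∀ a, q a = ‖S.mkQ (mk (halfSpacePresentation Ω d) a)‖ := fun _ => rfl
  have hadm : (bulkPresentation Ω d).IsAdmissible q :=
    { mul_le := fun a b => by
        rw [hq, map_mul]; exact norm_quotient_mul_le S hl hr _ _
      star_mul_self := fun a => by
        rw [hq, map_mul, map_star]; exact norm_quotient_star_mul_self S hl hr hs _
      rel := fun a b h => by
        have : S.mkQ (mk (halfSpacePresentation Ω d) (a - b)) = 0 :=
          (Submodule.Quotient.mk_eq_zero S).2 (mk_sub_mem_boundaryAlgebra h)
        rw [hq, this, norm_zero]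
      of_le := fun x => (Submodule.Quotient.norm_mk_le S _).trans (norm_gen_le x) }
  have hcont : Continuous fun b => ‖S.mkQ b‖ :=
    continuous_norm.comp (Submodule.continuous_mkQ S)
  refine denseRange_mk.induction_on (p := fun b => ‖S.mkQ b‖ ≤ ‖ev Ω d b‖) b
    (isClosed_le hcont (continuous_norm.comp continuous_ev)) fun a => ?_
  rw [ev_mk, norm_mk]
  exact hadm.le_univNorm a

theorem ev_eq_zero_iff {b : HalfSpaceAlgebra Ω d} :
    ev Ω d b = 0 ↔ b ∈ boundaryAlgebra Ω d := by
  constructor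
  · intro h
    have h1 := norm_mkQ_boundaryAlgebra_le b
    rw [h, norm_zero] at h1
    have h2 : b ∈ closure ((boundaryAlgebra Ω d).toSubmodule : Set (HalfSpaceAlgebra Ω d)) :=
      QuotientAddGroup.norm_mk_eq_zero_iff_mem_closure.1 (le_antisymm h1 (norm_nonneg _))
    have h3 : IsClosed (boundaryAlgebra Ω d : Set (HalfSpaceAlgebra Ω d)) := inferInstance
    exact h3.closure_subset h2
  · intro h
    have h' : b ∈ closure (algebraicIdeal (boundaryProjection Ω d)
      isSelfAdjoint_boundaryProjection : Set (HalfSpaceAlgebra Ω d)) := h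
    refine closure_minimal (t := {b | ev Ω d b = 0}) ?_
      (isClosed_eq continuous_ev continuous_const) h'
    intro y hy
    change y ∈ Submodule.span ℂ _ at hy
    show ev Ω d y = 0
    induction hy using Submodule.span_induction with
    | mem x h =>
      obtain ⟨c, c', rfl⟩ := h
      rw [map_mul, map_mul, ev_boundaryProjection, mul_zero, zero_mul]
    | zero => exact map_zero _
    | add x z _ _ h1 h2 => rw [map_add, h1, h2, add_zero]
    | smul c x _ h => rw [map_smul, h, smul_zero]

theorem denseRange_ev : DenseRange (ev Ω d) := by
  refine Dense.mono ?_ (denseRange_mk (P := bulkPresentation Ω d))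
  rintro _ ⟨a, rfl⟩
  exact ⟨_, ev_mk a⟩

/-- The range of `ev` is closed, because the quotient by the boundary algebra is complete and its
norm is dominated by the norm of the bulk algebra. -/
theorem ev_surjective : Function.Surjective (ev Ω d) := by
  let S : Submodule ℂ (HalfSpaceAlgebra Ω d) := (boundaryAlgebra Ω d).toSubmodule
  let E : HalfSpaceAlgebra Ω d →ₗ[ℂ] BulkAlgebra Ω d := (ev Ω d).toAlgHom.toLinearMap
  have hE : S ≤ LinearMap.ker E := fun x hx => ev_eq_zero_iff.2 hx
  let φ : (HalfSpaceAlgebra Ω d ⧸ S) →ₗ[ℂ] BulkAlgebra Ω d := S.liftQ E hE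
  have hφ : ∀ b, φ (S.mkQ b) = ev Ω d b := fun b => rfl
  have hc : Continuous φ := continuous_ev.quotient_lift _
  have hanti : AntilipschitzWith 1 φ := by
    refine AddMonoidHomClass.antilipschitz_of_bound φ fun x => ?_
    obtain ⟨b, rfl⟩ := S.mkQ_surjective x
    rw [hφ, NNReal.coe_one, one_mul]
    exact norm_mkQ_boundaryAlgebra_le b
  have huc : UniformContinuous φ := uniformContinuous_addMonoidHom_of_continuous hc
  have hcl : IsClosed (Set.range φ) := hanti.isClosed_range huc
  have hr : Set.range φ = Set.range (ev Ω d) := by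
    ext x
    constructor
    · rintro ⟨y, rfl⟩
      obtain ⟨b, rfl⟩ := S.mkQ_surjective y
      exact ⟨b, rfl⟩
    · rintro ⟨b, rfl⟩
      exact ⟨S.mkQ b, rfl⟩
  rw [← Set.range_eq_univ, ← hr, ← hcl.closure_eq, hr]
  exact denseRange_ev.closure_eq

end Exactness

/-! ### Exponentials of idempotents and lifts of symmetries -/

section Exponential

theorem exp_smul_of_isIdempotentElem {A : Type u} [CStarAlgebra A] {E : A}
    (hE : IsIdempotentElem E) (z : ℂ) :
    NormedSpace.exp (z • E) = 1 + (Complex.exp z - 1) • E := by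
  have h1 := NormedSpace.exp_series_hasSum_exp' (𝕂 := ℂ) (z • E)
  have h2 := (NormedSpace.exp_series_hasSum_exp' (𝕂 := ℂ) z).smul_const E
  have h3 : HasSum (fun n : ℕ => if n = 0 then 1 - E else 0) (1 - E) := hasSum_ite_eq 0 _
  have h4 : (fun n : ℕ => ((n.factorial : ℂ)⁻¹) • (z • E) ^ n) =
      fun n : ℕ => ((n.factorial : ℂ)⁻¹ • z ^ n) • E + if n = 0 then 1 - E else 0 := by
    funext n
    rcases n with _ | n
    · simp
    · rw [smul_pow, hE.pow_succ_eq, if_neg n.succ_ne_zero, add_zero, smul_assoc]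
  rw [h4] at h1
  rw [h1.unique (h2.add h3), ← Complex.exp_eq_exp_ℂ, sub_smul, one_smul]
  abel

theorem exp_two_pi_I_smul_of_isIdempotentElem {A : Type u} [CStarAlgebra A] {E : A}
    (hE : IsIdempotentElem E) :
    NormedSpace.exp ((2 * Real.pi * Complex.I : ℂ) • E) = 1 := by
  rw [exp_smul_of_isIdempotentElem hE, Complex.exp_two_pi_mul_I, sub_self, zero_smul, add_zero]

variable {A B : Type u} [CStarAlgebra A] [CStarAlgebra B]

open scoped CStarAlgebra in
theorem map_exp_starAlgHom (φ : B →⋆ₐ[ℂ] A) (x : B) :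
    φ (NormedSpace.exp x) = NormedSpace.exp (φ x) := by
  have hφ : Continuous φ := map_continuous φ
  let +nondep : NormedAlgebra ℚ B := .restrictScalars ℚ ℂ B
  let +nondep : NormedAlgebra ℚ A := .restrictScalars ℚ ℂ A
  exact NormedSpace.map_exp φ hφ x

theorem exists_isSelfAdjoint_lift {φ : B →⋆ₐ[ℂ] A} (hφ : Function.Surjective φ) {a : A}
    (ha : IsSelfAdjoint a) : ∃ b : B, IsSelfAdjoint b ∧ φ b = a := by
  obtain ⟨b, hb⟩ := hφ a
  refine ⟨(2⁻¹ : ℂ) • (b + star b), ?_, ?_⟩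
  · rw [IsSelfAdjoint, star_smul, star_add, star_star, add_comm (star b)]
    simp
  · rw [map_smul, map_add, map_star, hb, ha.star_eq, ← two_smul ℂ a, smul_smul]
    simp

/-- A self-adjoint unitary `w` is the exponential `exp(iπ(1-w)/2)`, hence lifts to a unitary. -/
theorem exists_unitary_lift {φ : B →⋆ₐ[ℂ] A} (hφ : Function.Surjective φ) {w : A}
    (hw : IsSelfAdjoint w) (hww : w * w = 1) : ∃ y ∈ unitary B, φ y = w := by
  set E : A := (2⁻¹ : ℂ) • (1 - w) with hE
  have hEsa : IsSelfAdjoint E := by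
    rw [IsSelfAdjoint, hE, star_smul, star_sub, star_one, hw.star_eq]
    simp
  have hEid : IsIdempotentElem E := by
    rw [IsIdempotentElem, hE, smul_mul_smul_comm]
    have : (1 - w) * (1 - w) = (2 : ℂ) • (1 - w) := by
      rw [mul_sub, sub_mul, sub_mul, hww, two_smul]; noncomm_ring
    rw [this, smul_smul]
    norm_num
  obtain ⟨b, hb, hbE⟩ := exists_isSelfAdjoint_lift hφ hEsa
  have hpb : IsSelfAdjoint (Real.pi • b) := (IsSelfAdjoint.all Real.pi).smul hb
  refine ⟨selfAdjoint.expUnitary ⟨Real.pi • b, hpb⟩, Subtype.property _, ?_⟩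
  rw [selfAdjoint.expUnitary_coe, map_exp_starAlgHom]
  have h1 : φ (Complex.I • Real.pi • b) = (Real.pi * Complex.I : ℂ) • E := by
    rw [← hbE, ← Complex.coe_smul, smul_smul, map_smul, mul_comm]
  rw [h1, exp_smul_of_isIdempotentElem hEid, Complex.exp_pi_mul_I, hE, smul_smul]
  norm_num

end Exponential

/-! ### Paths of unitary matrices -/

section UnitaryPaths

/-- If the spectrum of a unitary omits a point of the circle, then a rotation moves this point to
`-1`, and the rotated unitary has distance less than `2` from the identity. -/
theorem joined_one_of_exp_notMem_spectrum {A : Type u} [CStarAlgebra A] (s : unitary A) {θ : ℝ}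
    (hθ : Complex.exp (θ * Complex.I) ∉ spectrum ℂ (s : A)) : Joined 1 s := by
  have hsa : IsSelfAdjoint ((θ - Real.pi) • (1 : A)) :=
    (IsSelfAdjoint.all _).smul (IsSelfAdjoint.one _)
  set x : selfAdjoint A := ⟨_, hsa⟩ with hx
  set y : unitary A := selfAdjoint.expUnitary x with hy
  have hyc : (y : A) = Complex.exp ((θ - Real.pi : ℝ) * Complex.I) • 1 := by
    rw [hy, selfAdjoint.expUnitary_coe]
    show NormedSpace.exp (Complex.I • (θ - Real.pi) • (1 : A)) = _
    rw [← Complex.coe_smul, smul_smul, mul_comm, exp_smul_of_isIdempotentElem .one, sub_smul,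
      one_smul, add_sub_cancel]
  set c : ℂ := Complex.exp (-((θ - Real.pi : ℝ) * Complex.I)) with hc
  have hys : ((star y * s : unitary A) : A) = c • s.1 := by
    rw [Submonoid.coe_mul, Unitary.coe_star, hyc, star_smul, star_one, smul_one_mul, hc]
    congr 1
    rw [← starRingEnd_apply, ← Complex.exp_conj]
    simp
  have hspec : (-1 : ℂ) ∉ spectrum ℂ ((star y * s : unitary A) : A) := by
    rw [hys]
    have h1 : (-1 : ℂ) = c * Complex.exp (θ * Complex.I) := by
      rw [hc, ← Complex.exp_add, ← Complex.exp_pi_mul_I]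
      congr 1
      push_cast
      ring
    rw [h1]
    exact fun h => hθ ((spectrum.smul_mem_smul_iff
      (r := Units.mk0 c (Complex.exp_ne_zero _))).1 h)
  have hj := Unitary.joined 1 (star y * s)
    ((Unitary.norm_sub_one_lt_two_iff (star y * s).2).2 hspec)
  have := (selfAdjoint.joined_one_expUnitary x).mul hj
  rwa [← hy, one_mul, ← mul_assoc, Unitary.mul_star_self, one_mul] at this

open scoped ComplexOrder in
/-- The unitary group of `M_n(ℂ)` is path connected, because a finite spectrum omits a point of the
circle. -/
theorem joined_one_of_complex_matrix {ι : Type} [Fintype ι] [DecidableEq ι]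
    (s : unitary (Matrix ι ι ℂ)) : Joined (1 : unitary (Matrix ι ι ℂ)) s := by
  have hfin : (spectrum ℂ (s.1 : Matrix ι ι ℂ)).Finite := Matrix.finite_spectrum _
  -- The points `exp(iθ)` with `-π < θ ≤ π` are distinct.
  have hinf : (Set.range fun t : ℝ => Complex.exp (t * Complex.I)).Infinite := by
    refine ((Set.Ioc_infinite Real.pi_pos).image (f := fun t : ℝ => Complex.exp (t * Complex.I))
      fun x hx y hy hxy => ?_).mono (Set.image_subset_range _ _)
    have h := Complex.exp_inj_of_neg_pi_lt_of_le_pi (x := x * Complex.I) (y := y * Complex.I)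
      (by simp; linarith [hx.1, Real.pi_pos]) (by simpa using hx.2)
      (by simp; linarith [hy.1, Real.pi_pos]) (by simpa using hy.2) hxy
    exact_mod_cast mul_right_cancel₀ Complex.I_ne_zero h
  obtain ⟨_, ⟨θ, rfl⟩, hθ⟩ := hinf.exists_notMem_finite hfin
  exact joined_one_of_exp_notMem_spectrum (A := CStarMatrix ι ι ℂ) s hθ

variable {B : Type u} [CStarAlgebra B] {J : NonUnitalStarSubalgebra ℂ B}

/-- The scalar part of an element of the unitization, as a `*`-homomorphism. -/
noncomputable def scalarPart (J : NonUnitalStarSubalgebra ℂ B) : Unitization ℂ J →⋆ₐ[ℂ] ℂ where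
  toAlgHom := Unitization.fstHom ℂ J
  map_star' := Unitization.fst_star

theorem scalarPart_apply (x : Unitization ℂ J) : scalarPart J x = x.fst := rfl

theorem unitizationInclusion_apply (x : Unitization ℂ J) :
    unitizationInclusion J x = algebraMap ℂ B (scalarPart J x) + x.snd := rfl

/-- The entrywise application of a `*`-homomorphism to square matrices. -/
def matrixMap {ι : Type} [Fintype ι] [DecidableEq ι] {R S : Type*} [Ring R] [StarRing R]
    [Algebra ℂ R] [Ring S] [StarRing S] [Algebra ℂ S] (φ : R →⋆ₐ[ℂ] S) :
    Matrix ι ι R →⋆ₐ[ℂ] Matrix ι ι S where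
  toAlgHom := φ.toAlgHom.mapMatrix
  map_star' x := Matrix.ext fun i j => map_star φ (x j i)

@[simp]
theorem matrixMap_apply {ι : Type} [Fintype ι] [DecidableEq ι] {R S : Type*} [Ring R] [StarRing R]
    [Algebra ℂ R] [Ring S] [StarRing S] [Algebra ℂ S] (φ : R →⋆ₐ[ℂ] S) (x : Matrix ι ι R)
    (i j : ι) : matrixMap φ x i j = φ (x i j) := rfl

variable {ι : Type} [Fintype ι] [DecidableEq ι]

/-- A matrix over the unitization is determined by its scalar part and its image over `B`. -/
theorem matrix_unitization_ext {x y : Matrix ι ι (Unitization ℂ J)}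
    (h1 : matrixMap (scalarPart J) x = matrixMap (scalarPart J) y)
    (h2 : matrixMap (unitizationInclusion J) x = matrixMap (unitizationInclusion J) y) :
    x = y := by
  ext i j
  · exact congrFun (congrFun h1 i) j
  · have h3 : scalarPart J (x i j) = scalarPart J (y i j) := congrFun (congrFun h1 i) j
    have h4 : unitizationInclusion J (x i j) = unitizationInclusion J (y i j) :=
      congrFun (congrFun h2 i) j
    rw [unitizationInclusion_apply, unitizationInclusion_apply, h3] at h4
    exact add_left_cancel h4

/-- Unitarity over the unitization can be tested on the scalar part and on the image over `B`. -/
theorem mem_unitary_matrix_unitization {x : Matrix ι ι (Unitization ℂ J)}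
    (h1 : matrixMap (scalarPart J) x ∈ unitary (Matrix ι ι ℂ))
    (h2 : matrixMap (unitizationInclusion J) x ∈ unitary (Matrix ι ι B)) :
    x ∈ unitary (Matrix ι ι (Unitization ℂ J)) := by
  rw [Unitary.mem_iff] at h1 h2 ⊢
  constructor
  · exact matrix_unitization_ext (by rw [map_mul, map_star, map_one, h1.1])
      (by rw [map_mul, map_star, map_one, h2.1])
  · exact matrix_unitization_ext (by rw [map_mul, map_star, map_one, h1.2])
      (by rw [map_mul, map_star, map_one, h2.2])

theorem matrixMap_mem_unitary {R S : Type*} [Ring R] [StarRing R]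
    [Algebra ℂ R] [Ring S] [StarRing S] [Algebra ℂ S] (φ : R →⋆ₐ[ℂ] S) {x : Matrix ι ι R}
    (hx : x ∈ unitary (Matrix ι ι R)) : matrixMap φ x ∈ unitary (Matrix ι ι S) := by
  rw [Unitary.mem_iff] at hx ⊢
  rw [← map_star, ← map_mul, ← map_mul, hx.1, hx.2, map_one]
  exact ⟨rfl, rfl⟩

/-- The matrix over the unitization with scalar part `s` and image `y` over `B`. -/
noncomputable def unitizationMatrix (s : Matrix ι ι ℂ) (y : Matrix ι ι B)
    (h : ∀ i j, y i j - algebraMap ℂ B (s i j) ∈ J) : Matrix ι ι (Unitization ℂ J) :=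
  fun i j => Unitization.inl (s i j) + Unitization.inr ⟨_, h i j⟩

theorem matrixMap_scalarPart_unitizationMatrix {s : Matrix ι ι ℂ} {y : Matrix ι ι B}
    (h : ∀ i j, y i j - algebraMap ℂ B (s i j) ∈ J) :
    matrixMap (scalarPart J) (unitizationMatrix s y h) = s := by
  ext i j
  simp [scalarPart_apply, unitizationMatrix]

theorem matrixMap_unitizationInclusion_unitizationMatrix {s : Matrix ι ι ℂ} {y : Matrix ι ι B}
    (h : ∀ i j, y i j - algebraMap ℂ B (s i j) ∈ J) :
    matrixMap (unitizationInclusion J) (unitizationMatrix s y h) = y := by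
  ext i j
  simp [unitizationInclusion_apply, scalarPart_apply, unitizationMatrix]

theorem unitizationMatrix_mem_unitary {s : Matrix ι ι ℂ} {y : Matrix ι ι B}
    (h : ∀ i j, y i j - algebraMap ℂ B (s i j) ∈ J) (hs : s ∈ unitary (Matrix ι ι ℂ))
    (hy : y ∈ unitary (Matrix ι ι B)) :
    unitizationMatrix s y h ∈ unitary (Matrix ι ι (Unitization ℂ J)) :=
  mem_unitary_matrix_unitization (by rwa [matrixMap_scalarPart_unitizationMatrix])
    (by rwa [matrixMap_unitizationInclusion_unitizationMatrix])

theorem continuous_unitizationMatrix [IsClosed (J : Set B)] {X : Type*} [TopologicalSpace X]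
    {s : X → Matrix ι ι ℂ} {y : X → Matrix ι ι B}
    (h : ∀ x i j, y x i j - algebraMap ℂ B (s x i j) ∈ J)
    (hs : Continuous s) (hy : Continuous y) :
    Continuous fun x => unitizationMatrix (s x) (y x) (h x) := by
  refine continuous_matrix fun i j => Continuous.add ?_ ?_
  · exact (continuous_algebraMap ℂ (Unitization ℂ J)).comp (hs.matrix_elem i j)
  · exact Unitization.continuous_inr.comp (Continuous.subtype_mk
      ((hy.matrix_elem i j).sub ((continuous_algebraMap ℂ B).comp (hs.matrix_elem i j))) _)

/-- Two unitaries over the unitization with the same image over `B` are joined by a path. If `J`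
does not contain the unit of `B` they are equal; otherwise their scalar parts may differ, and the
scalar part can be moved inside the connected group of unitary complex matrices. -/
theorem joined_of_matrixMap_unitizationInclusion_eq [IsClosed (J : Set B)]
    {v w : unitary (Matrix ι ι (Unitization ℂ J))}
    (hvw : matrixMap (unitizationInclusion J) v.1 = matrixMap (unitizationInclusion J) w.1)
    (hl : ∀ b, ∀ x ∈ J, b * x ∈ J) : Joined v w := by
  by_cases h1 : (1 : B) ∈ J
  · have hJ : ∀ b, b ∈ J := fun b => by simpa using hl b 1 h1
    let y : Matrix ι ι B := matrixMap (unitizationInclusion J) v.1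
    have hy : y ∈ unitary (Matrix ι ι B) := matrixMap_mem_unitary _ v.2
    let Φ : unitary (Matrix ι ι ℂ) → unitary (Matrix ι ι (Unitization ℂ J)) := fun s =>
      ⟨unitizationMatrix s.1 y fun _ _ => hJ _, unitizationMatrix_mem_unitary _ s.2 hy⟩
    have hΦ : Continuous Φ := Continuous.subtype_mk
      (continuous_unitizationMatrix _ continuous_subtype_val continuous_const) _
    have hΦs : ∀ z : unitary (Matrix ι ι (Unitization ℂ J)),
        matrixMap (unitizationInclusion J) z.1 = y →
        Φ ⟨_, matrixMap_mem_unitary (scalarPart J) z.2⟩ = z := fun z hz =>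
      Subtype.ext (matrix_unitization_ext (matrixMap_scalarPart_unitizationMatrix _)
        ((matrixMap_unitizationInclusion_unitizationMatrix _).trans hz.symm))
    have hj : ∀ s t : unitary (Matrix ι ι ℂ), Joined (Φ s) (Φ t) := fun s t =>
      ⟨((joined_one_of_complex_matrix s).symm.trans
        (joined_one_of_complex_matrix t)).somePath.map hΦ⟩
    have := hj ⟨_, matrixMap_mem_unitary (scalarPart J) v.2⟩
      ⟨_, matrixMap_mem_unitary (scalarPart J) w.2⟩
    rwa [hΦs v rfl, hΦs w hvw.symm] at this
  · have : v = w := by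
      refine Subtype.ext (matrix_unitization_ext (Matrix.ext fun i j => ?_) hvw)
      have h2 : unitizationInclusion J (v.1 i j) = unitizationInclusion J (w.1 i j) :=
        congrFun (congrFun hvw i) j
      rw [unitizationInclusion_apply, unitizationInclusion_apply] at h2
      show scalarPart J (v.1 i j) = scalarPart J (w.1 i j)
      by_contra hne
      set c := scalarPart J (v.1 i j) - scalarPart J (w.1 i j) with hc
      have hcJ : algebraMap ℂ B c ∈ J := by
        have : algebraMap ℂ B c = ((w.1 i j).snd : B) - (v.1 i j).snd := by
          rw [hc, map_sub, sub_eq_sub_iff_add_eq_add, h2, add_comm]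
        rw [this]
        exact sub_mem (w.1 i j).snd.2 (v.1 i j).snd.2
      refine h1 ?_
      have := hl (algebraMap ℂ B c⁻¹) _ hcJ
      rwa [← map_mul, inv_mul_cancel₀ (sub_ne_zero.2 hne), map_one] at this
    rw [this]

end UnitaryPaths

/-! ### Paths of unitaries from lifts of projections -/

section ProjectionLift

open Matrix

variable {A B : Type u} [CStarAlgebra A] [PartialOrder A] [StarOrderedRing A]
  [CStarAlgebra B] [PartialOrder B] [StarOrderedRing B]

/-- The entrywise application of a `*`-homomorphism to matrices over `C*`-algebras. -/
noncomputable def cstarMatrixMap (ι : Type) [Fintype ι] [DecidableEq ι] (φ : B →⋆ₐ[ℂ] A) :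
    CStarMatrix ι ι B →⋆ₐ[ℂ] CStarMatrix ι ι A where
  toFun x := CStarMatrix.map x φ
  map_one' := map_one (matrixMap φ)
  map_mul' := map_mul (matrixMap (ι := ι) φ)
  map_zero' := map_zero (matrixMap (ι := ι) φ)
  map_add' := map_add (matrixMap (ι := ι) φ)
  commutes' := AlgHomClass.commutes (matrixMap (ι := ι) φ)
  map_star' := map_star (matrixMap (ι := ι) φ)

variable {ι κ : Type} [Fintype ι] [DecidableEq ι] [Fintype κ] [DecidableEq κ]

theorem cstarMatrixMap_surjective {φ : B →⋆ₐ[ℂ] A} (hφ : Function.Surjective φ) :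
    Function.Surjective (cstarMatrixMap ι φ) := fun x => by
  choose g hg using hφ
  exact ⟨x.map g, CStarMatrix.ext fun i j => hg (x i j)⟩

/-- If the self-adjoint elements `a` and `P` have the same image, and `P` is a projection, then the
segment from `a` to `P` has the same projection as its image, so that `exp(2πi ·)` turns it into a
path of unitaries with image `1`. This path ends in `exp(2πi P) = 1`. -/
theorem exists_unitary_path {C D : Type u} [CStarAlgebra C] [CStarAlgebra D] (φ : C →⋆ₐ[ℂ] D)
    {a P : C} (ha : IsSelfAdjoint a) (hP : IsStarProjection P) (hPa : φ a = φ P) :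
    ∃ y : ℝ → C, Continuous y ∧ (∀ t, y t ∈ unitary C) ∧ (∀ t, φ (y t) = 1) ∧
      y 0 = NormedSpace.exp ((2 * Real.pi * Complex.I : ℂ) • a) ∧ y 1 = 1 := by
  have hsa : ∀ t : ℝ, IsSelfAdjoint ((2 * Real.pi) • (a + t • (P - a))) := fun t =>
    (IsSelfAdjoint.all (2 * Real.pi)).smul
      (ha.add ((IsSelfAdjoint.all t).smul (hP.isSelfAdjoint.sub ha)))
  let y : ℝ → unitary C := fun t => selfAdjoint.expUnitary ⟨_, hsa t⟩
  have hyt : ∀ t, (y t : C) =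
      NormedSpace.exp ((2 * Real.pi * Complex.I : ℂ) • (a + t • (P - a))) := fun t => by
    show NormedSpace.exp (Complex.I • (2 * Real.pi) • (a + t • (P - a))) = _
    rw [← Complex.coe_smul, smul_smul, mul_comm]
    push_cast
    rfl
  refine ⟨fun t => y t, continuous_subtype_val.comp (selfAdjoint.continuous_expUnitary.comp
    (Continuous.subtype_mk (by fun_prop) _)), fun t => (y t).2, fun t => ?_, ?_, ?_⟩
  · have h1 : φ (a + t • (P - a)) = φ P := by
      rw [← Complex.coe_smul, map_add, map_smul, map_sub, hPa, sub_self, smul_zero, add_zero]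
    show φ (y t) = 1
    rw [hyt, map_exp_starAlgHom, map_smul, h1]
    refine exp_two_pi_I_smul_of_isIdempotentElem ?_
    rw [IsIdempotentElem, ← map_mul, hP.isIdempotentElem.eq]
  · exact (hyt 0).trans (by rw [zero_smul, add_zero])
  · refine (hyt 1).trans ?_
    rw [one_smul, add_sub_cancel, exp_two_pi_I_smul_of_isIdempotentElem hP.isIdempotentElem]

/-- Let the self-adjoint matrices `a` and `P` over `B` have the same image over `A = B / J`, and let
`P` be a projection. The unitaries on the path from `exp(2πi a)` to `1` over `B` are `1` modulo `J`,
so they lift to unitaries over the unitization of `J` with scalar part `1`. -/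
theorem joined_one_of_projection_lift {π : B →⋆ₐ[ℂ] A} {J : NonUnitalStarSubalgebra ℂ B}
    [IsClosed (J : Set B)] (hJ : ∀ b, π b = 0 ↔ b ∈ J) {a P : CStarMatrix ι ι B}
    (ha : IsSelfAdjoint a) (hP : IsStarProjection P) (hPa : a.map π = P.map π)
    (v : unitary (Matrix ι ι (Unitization ℂ J)))
    (hv : ∀ i j, unitizationInclusion J (v.1 i j) =
      NormedSpace.exp ((2 * Real.pi * Complex.I : ℂ) • a) i j) : Joined v 1 := by
  obtain ⟨y, hyc, hyu, hy1, hy_zero, hy_one⟩ := exists_unitary_path (cstarMatrixMap ι π) ha hP hPa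
  have hmem : ∀ (t : ℝ) (i j : ι),
      y t i j - algebraMap ℂ B ((1 : Matrix ι ι ℂ) i j) ∈ J := by
    intro t i j
    rw [← hJ, map_sub, sub_eq_zero]
    have h2 : π (y t i j) = (1 : CStarMatrix ι ι A) i j :=
      congrFun (congrFun (hy1 t) i) j
    rw [h2, CStarMatrix.one_apply, Matrix.one_apply]
    split_ifs <;> simp
  let w : ℝ → unitary (Matrix ι ι (Unitization ℂ J)) := fun t =>
    ⟨unitizationMatrix 1 (y t) (hmem t), unitizationMatrix_mem_unitary _ (one_mem _) (hyu t)⟩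
  have hwc : Continuous w := Continuous.subtype_mk
    (continuous_unitizationMatrix _ continuous_const hyc) _
  have hw : ∀ t, matrixMap (unitizationInclusion J) (w t).1 = y t := fun t =>
    matrixMap_unitizationInclusion_unitizationMatrix _
  have hl : ∀ b, ∀ x ∈ J, b * x ∈ J := fun b x hx => by
    rw [← hJ] at hx ⊢
    rw [map_mul, hx, mul_zero]
  have h0 : Joined v (w 0) := by
    refine joined_of_matrixMap_unitizationInclusion_eq ?_ hl
    rw [hw]
    ext i j
    rw [matrixMap_apply, hv]
    exact (congrFun (congrFun hy_zero i) j).symm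
  have h1 : Joined (w 1) 1 := by
    refine joined_of_matrixMap_unitizationInclusion_eq ?_ hl
    rw [hw]
    exact hy_one.trans (map_one (matrixMap (ι := ι) (unitizationInclusion J))).symm
  have h01 : Joined (w 0) (w 1) := by
    refine ⟨⟨⟨fun t : unitInterval => w t, hwc.comp continuous_subtype_val⟩, ?_, ?_⟩⟩ <;> simp
  exact (h0.trans h01).trans h1

/-! ### Stable equivalence of projections, and lifts of projections -/

/-- If a projection `Q` lifts, so does every projection `P` that is Murray-von Neumann equivalent to
it, up to a zero block: for `P = v^* v` and `Q = v v^*` the matrix with rows `1 - P, v^*` and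
`v, 1 - Q` is a self-adjoint unitary that conjugates `0 ⊕ Q` to `P ⊕ 0`, and it lifts to a
unitary. -/
theorem exists_projection_lift_of_MvNEquivalent {π : B →⋆ₐ[ℂ] A} (hπ : Function.Surjective π)
    {P : Matrix ι ι A} (hP : IsStarProjection P) {Q : Matrix κ κ B} (hQ : IsStarProjection Q)
    (h : MvNEquivalent P (Q.map π)) :
    ∃ R : Matrix (ι ⊕ κ) (ι ⊕ κ) B, IsStarProjection R ∧ R.map π = fromBlocks P 0 0 0 := by
  set q : Matrix κ κ A := Q.map π with hq
  have hqq : q * q = q := by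
    have := congrArg (matrixMap π) hQ.isIdempotentElem.eq
    rwa [map_mul] at this
  have hqs : qᴴ = q := by
    have := congrArg (matrixMap π) hQ.isSelfAdjoint.star_eq
    rwa [map_star] at this
  have hPP : P * P = P := hP.isIdempotentElem
  have hPs : Pᴴ = P := hP.isSelfAdjoint
  obtain ⟨v₀, h1, h2⟩ := h
  -- The partial isometry is replaced by one whose domain and range are those of `P` and `Q`.
  set v := q * v₀ with hv
  have hvs : vᴴ = v₀ᴴ * q := by rw [hv, conjTranspose_mul, hqs]
  have hvv : vᴴ * v = P := by
    calc vᴴ * v = v₀ᴴ * (q * q) * v₀ := by rw [hvs, hv]; simp only [Matrix.mul_assoc]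
      _ = (v₀ᴴ * v₀) * (v₀ᴴ * v₀) := by rw [hqq, h2]; simp only [Matrix.mul_assoc]
      _ = P := by rw [← h1, hPP]
  have hvv' : v * vᴴ = q := by
    calc v * vᴴ = q * (v₀ * v₀ᴴ) * q := by rw [hvs, hv]; simp only [Matrix.mul_assoc]
      _ = q := by rw [← h2, hqq, hqq]
  have hqv : q * v = v := by rw [hv, ← Matrix.mul_assoc, hqq]
  have hvP : v * P = v := by rw [← hvv, ← Matrix.mul_assoc, hvv', hqv]
  have hvq : vᴴ * q = vᴴ := by rw [← hqs, ← conjTranspose_mul, hqv]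
  have hPv : P * vᴴ = vᴴ := by rw [← hPs, ← conjTranspose_mul, hvP]
  let w : CStarMatrix (ι ⊕ κ) (ι ⊕ κ) A := fromBlocks (1 - P) vᴴ v (1 - q)
  have hws : IsSelfAdjoint w := by
    show (fromBlocks (1 - P) vᴴ v (1 - q))ᴴ = fromBlocks (1 - P) vᴴ v (1 - q)
    rw [fromBlocks_conjTranspose, conjTranspose_conjTranspose, conjTranspose_sub,
      conjTranspose_sub, conjTranspose_one, conjTranspose_one, hPs, hqs]
  have hww : w * w = 1 := by
    show fromBlocks (1 - P) vᴴ v (1 - q) * fromBlocks (1 - P) vᴴ v (1 - q) =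
      (1 : Matrix (ι ⊕ κ) (ι ⊕ κ) A)
    rw [fromBlocks_multiply, ← fromBlocks_one]
    congr 1
    · simp [hvv, Matrix.sub_mul, Matrix.mul_sub, hPP]
    · rw [Matrix.sub_mul, Matrix.mul_sub, hPv, hvq]; simp
    · rw [Matrix.sub_mul, Matrix.mul_sub, hvP, hqv]; simp
    · simp [hvv', Matrix.sub_mul, Matrix.mul_sub, hqq]
  obtain ⟨y, hy, hyw⟩ := exists_unitary_lift (cstarMatrixMap_surjective (ι := ι ⊕ κ) hπ) hws hww
  let Q₀ : CStarMatrix (ι ⊕ κ) (ι ⊕ κ) B := fromBlocks 0 0 0 Q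
  have hQ₀P : IsStarProjection Q₀ := isStarProjection_fromBlocks (IsStarProjection.zero _) hQ
  have hπQ₀ : cstarMatrixMap (ι ⊕ κ) π Q₀ = fromBlocks 0 0 0 q := by
    show (fromBlocks 0 0 0 Q).map π = _
    rw [fromBlocks_map]
    simp [hq]
  refine ⟨y * Q₀ * star y, ⟨?_, ?_⟩, ?_⟩
  · show y * Q₀ * star y * (y * Q₀ * star y) = y * Q₀ * star y
    calc y * Q₀ * star y * (y * Q₀ * star y) = y * Q₀ * (star y * y) * Q₀ * star y := by
          simp only [mul_assoc]
      _ = y * (Q₀ * Q₀) * star y := by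
          rw [Unitary.star_mul_self_of_mem hy, mul_one]; simp only [mul_assoc]
      _ = _ := by rw [hQ₀P.isIdempotentElem.eq]
  · exact hQ₀P.isSelfAdjoint.conjugate y
  · show cstarMatrixMap (ι ⊕ κ) π (y * Q₀ * star y) = _
    rw [map_mul, map_mul, map_star, hyw, hws.star_eq, hπQ₀]
    show fromBlocks (1 - P) vᴴ v (1 - q) * (fromBlocks 0 0 0 q : Matrix (ι ⊕ κ) (ι ⊕ κ) A) *
      fromBlocks (1 - P) vᴴ v (1 - q) = _
    rw [fromBlocks_multiply, fromBlocks_multiply]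
    congr 1
    · simp [hvq, hvv]
    · simp [Matrix.mul_sub, hvq]
    · simp [Matrix.sub_mul, hqq]
    · simp [Matrix.sub_mul, hqq]

/-- The row with entries `r` and `1 - r` is a partial isometry between `r ⊕ (1 - r)` and `1`. -/
theorem directSum_compl_equivalent_one {A : Type u} [Ring A] [StarRing A] {n : ℕ}
    {r : Matrix (Fin n) (Fin n) A} (hr : IsStarProjection r) :
    (⟨n, r, hr⟩ : MatrixProjection A).directSum ⟨n, 1 - r, hr.one_sub⟩ ≈
      MatrixProjection.one A n := by
  have hrr : r * r = r := hr.isIdempotentElem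
  have hrs : rᴴ = r := hr.isSelfAdjoint
  have h : MvNEquivalent (fromBlocks r 0 0 (1 - r)) (1 : Matrix (Fin n) (Fin n) A) := by
    refine ⟨fromCols r (1 - r), ?_, ?_⟩
    · rw [conjTranspose_fromCols_eq_fromRows_conjTranspose, fromRows_mul_fromCols,
        conjTranspose_sub, conjTranspose_one, hrs]
      simp [Matrix.mul_sub, Matrix.sub_mul, hrr]
    · rw [conjTranspose_fromCols_eq_fromRows_conjTranspose, fromCols_mul_fromRows,
        conjTranspose_sub, conjTranspose_one, hrs]
      simp [Matrix.mul_sub, Matrix.sub_mul, hrr]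
  exact (MatrixProjection.fromBlocks_equivalent_directSum ⟨n, r, hr⟩ ⟨n, 1 - r, hr.one_sub⟩).symm
    |>.trans (MatrixProjection.isStarProjection _) (MatrixProjection.isStarProjection _) h

/-- Equality in `K_0` is Murray-von Neumann equivalence after adding a unit: a stabilizing
projection can be completed to a unit by its complement. -/
theorem exists_directSum_one_equivalent_of_K0_eq {A : Type u} [CStarAlgebra A]
    {p q : MatrixProjection A} {k : ℕ}
    (h : K0.mk p = K0.mk q - K0.mk (MatrixProjection.one A k)) :
    ∃ m, q.directSum (MatrixProjection.one A m) ≈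
      (p.directSum (MatrixProjection.one A k)).directSum (MatrixProjection.one A m) := by
  let c : MatrixProjection A → ProjectionClass A := fun p => Quotient.mk _ p
  have hc : ∀ p q, c (p.directSum q) = c p + c q := fun _ _ => rfl
  rw [eq_sub_iff_add_eq] at h
  have h' : Algebra.GrothendieckAddGroup.of (c q) =
      Algebra.GrothendieckAddGroup.of (c p + c (MatrixProjection.one A k)) := by
    rw [map_add]; exact h.symm
  obtain ⟨⟨r, _⟩, hr⟩ := (AddSubmonoid.LocalizationMap.eq_iff_exists (AddLocalization.addMonoidOf
    (⊤ : AddSubmonoid (ProjectionClass A)))).1 h'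
  obtain ⟨r, rfl⟩ := Quotient.exists_rep r
  refine ⟨r.size, Quotient.exact (s := MatrixProjection.setoid) ?_⟩
  change c (q.directSum _) = c ((p.directSum _).directSum _)
  change c r + c q = c r + (c p + c (MatrixProjection.one A k)) at hr
  have hrc : c (MatrixProjection.one A r.size) =
      c r + c ⟨r.size, 1 - r.val, r.isStarProjection.one_sub⟩ :=
    (Quotient.sound (directSum_compl_equivalent_one r.isStarProjection)).symm
  rw [hc, hc, hc, hrc, ← add_assoc, add_comm (c q), hr]
  abel

end ProjectionLift

/-! ### The exponential map on classes of projections that lift -/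

section ExponentialMap

open Matrix

variable {A B : Type u} [CStarAlgebra A] [PartialOrder A] [StarOrderedRing A]
  [CStarAlgebra B] [PartialOrder B] [StarOrderedRing B]
variable {ι κ μ : Type} [Fintype ι] [DecidableEq ι] [Fintype κ] [DecidableEq κ] [Fintype μ]
  [DecidableEq μ]

/-- The block diagonal sum of two square matrices, with the rows of the sum enumerated by `f`. -/
def blockSumMatrix {R : Type*} [Ring R] [StarRing R] [Algebra ℂ R] (f : ι ⊕ κ ≃ μ) :
    Matrix ι ι R × Matrix κ κ R →⋆ₐ[ℂ] Matrix μ μ R where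
  toFun x := (fromBlocks x.1 0 0 x.2).submatrix f.symm f.symm
  map_one' := by rw [Prod.fst_one, Prod.snd_one, fromBlocks_one, submatrix_one_equiv]
  map_mul' x y := by
    rw [submatrix_mul_equiv, fromBlocks_multiply]
    simp
  map_zero' := by simp
  map_add' x y := by
    ext i j
    rw [Matrix.add_apply, submatrix_apply, submatrix_apply, submatrix_apply]
    rcases f.symm i with i | i <;> rcases f.symm j with j | j <;> simp
  commutes' c := by
    ext i j
    obtain ⟨i, rfl⟩ := f.surjective i
    obtain ⟨j, rfl⟩ := f.surjective j
    rw [submatrix_apply, f.symm_apply_apply, f.symm_apply_apply]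
    rcases i with i | i <;> rcases j with j | j <;>
      simp [algebraMap_matrix_apply, f.injective.eq_iff]
  map_star' x := by
    rw [star_eq_conjTranspose, conjTranspose_submatrix, fromBlocks_conjTranspose]
    simp [star_eq_conjTranspose]

/-- The block diagonal sum of two square matrices over a `C*`-algebra. The matrix types
carry `C*`-norms, so that the exponential of a block diagonal sum can be computed blockwise. -/
noncomputable def blockSum (f : ι ⊕ κ ≃ μ) :
    CStarMatrix ι ι B × CStarMatrix κ κ B →⋆ₐ[ℂ] CStarMatrix μ μ B where
  toFun := blockSumMatrix (R := B) f
  map_one' := map_one (blockSumMatrix (R := B) f)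
  map_mul' := map_mul (blockSumMatrix (R := B) f)
  map_zero' := map_zero (blockSumMatrix (R := B) f)
  map_add' := map_add (blockSumMatrix (R := B) f)
  commutes' := AlgHomClass.commutes (blockSumMatrix (R := B) f)
  map_star' := map_star (blockSumMatrix (R := B) f)

section Entries

variable (f : ι ⊕ κ ≃ μ) (x : CStarMatrix ι ι B × CStarMatrix κ κ B)

theorem blockSum_apply (i j : ι ⊕ κ) : blockSum f x (f i) (f j) =
    fromBlocks (CStarMatrix.ofMatrix.symm x.1) 0 0 (CStarMatrix.ofMatrix.symm x.2) i j := by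
  show fromBlocks (CStarMatrix.ofMatrix.symm x.1) 0 0 (CStarMatrix.ofMatrix.symm x.2)
    (f.symm (f i)) (f.symm (f j)) = _
  rw [f.symm_apply_apply, f.symm_apply_apply]

theorem blockSum_apply_inl_inl (i j : ι) :
    blockSum f x (f (Sum.inl i)) (f (Sum.inl j)) = x.1 i j := blockSum_apply f x _ _

theorem blockSum_apply_inl_inr (i : ι) (j : κ) :
    blockSum f x (f (Sum.inl i)) (f (Sum.inr j)) = 0 := blockSum_apply f x _ _

theorem blockSum_apply_inr_inl (i : κ) (j : ι) :
    blockSum f x (f (Sum.inr i)) (f (Sum.inl j)) = 0 := blockSum_apply f x _ _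

theorem blockSum_apply_inr_inr (i j : κ) :
    blockSum f x (f (Sum.inr i)) (f (Sum.inr j)) = x.2 i j := blockSum_apply f x _ _

end Entries

theorem exp_blockSum (f : ι ⊕ κ ≃ μ) (x : CStarMatrix ι ι B) (y : CStarMatrix κ κ B) :
    NormedSpace.exp (blockSum f (x, y)) =
      blockSum f (NormedSpace.exp x, NormedSpace.exp y) := by
  rw [← map_exp_starAlgHom]
  congr 1
  exact Prod.ext (map_exp_starAlgHom (StarAlgHom.fst ℂ _ _) (x, y))
    (map_exp_starAlgHom (StarAlgHom.snd ℂ _ _) (x, y))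

theorem K1.mk_one {J : Type u} [NonUnitalCStarAlgebra J] (n : ℕ) :
    K1.mk (1 : unitary (Matrix (Fin n) (Fin n) (Unitization ℂ J))) = 1 := by
  refine Quotient.sound (s := MatrixUnitary.setoid)
    ⟨max n 1, le_max_left _ _, le_max_right _ _, ?_⟩
  have h : ∀ {n k : ℕ} (h : n ≤ k),
      MatrixUnitary.pad h (1 : unitary (Matrix (Fin n) (Fin n) (Unitization ℂ J))) = 1 :=
    fun h => Subtype.ext (MatrixUnitary.padMatrix_one h)
  exact (congrArg₂ Joined (h _) (h _)).mpr (Joined.refl _)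

/-- The exponential map takes the class of a projection that lifts to a projection to the neutral
element, whichever representative and lift are used to compute it. -/
theorem eq_one_of_isExponential_of_lift {π : B →⋆ₐ[ℂ] A} (hπ : Function.Surjective π)
    {J : NonUnitalStarSubalgebra ℂ B} [IsClosed (J : Set B)] (hJ : ∀ b, π b = 0 ↔ b ∈ J) {n : ℕ}
    {P : Matrix (Fin n) (Fin n) B} (hP : IsStarProjection P) {Q : Matrix (Fin n) (Fin n) A}
    (hQ : IsStarProjection Q) (hPQ : P.map π = Q) {y : K1 J}
    (h : IsExponential π J (K0.mk ⟨n, Q, hQ⟩) y) : y = 1 := by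
  obtain ⟨p, k, a, v, hx, rfl, ha, hap, hv⟩ := h
  obtain ⟨m, hm⟩ := exists_directSum_one_equivalent_of_K0_eq hx
  -- The projection over `B` lifting the right-hand side of the stable equivalence.
  let T : Matrix ((Fin n ⊕ Fin k) ⊕ Fin m) ((Fin n ⊕ Fin k) ⊕ Fin m) B :=
    fromBlocks (fromBlocks P 0 0 1) 0 0 1
  have hT : IsStarProjection T :=
    isStarProjection_fromBlocks (isStarProjection_fromBlocks hP (.one _)) (.one _)
  have hπT : T.map π = fromBlocks (fromBlocks Q 0 0 1) 0 0 1 := by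
    simp only [T, fromBlocks_map, hPQ]
    simp
  have hp1 : IsStarProjection (fromBlocks p.val 0 0 (1 : Matrix (Fin m) (Fin m) A)) :=
    isStarProjection_fromBlocks p.isStarProjection (.one _)
  have hQ1 : IsStarProjection (fromBlocks Q 0 0 (1 : Matrix (Fin k) (Fin k) A)) :=
    isStarProjection_fromBlocks hQ (.one _)
  have hQ2 : IsStarProjection (T.map π) := hπT ▸ isStarProjection_fromBlocks hQ1 (.one _)
  let pQ : MatrixProjection A := ⟨n, Q, hQ⟩
  have hequiv : MvNEquivalent (fromBlocks p.val 0 0 (1 : Matrix (Fin m) (Fin m) A)) (T.map π) := by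
    have h1 := MatrixProjection.fromBlocks_equivalent_directSum p (MatrixProjection.one A m)
    have h2 := MatrixProjection.fromBlocks_equivalent_directSum
      (pQ.directSum (MatrixProjection.one A k)) (MatrixProjection.one A m)
    have h3 := MvNEquivalent.fromBlocks
      (MatrixProjection.fromBlocks_equivalent_directSum pQ (MatrixProjection.one A k))
      (MvNEquivalent.refl (MatrixProjection.one A m).isStarProjection)
    have h4 := (h1.trans hp1 (MatrixProjection.isStarProjection _) hm)
    have h5 := h3.trans (hπT ▸ hQ2) (MatrixProjection.isStarProjection _) h2
    rw [hπT]
    exact h4.trans hp1 (hπT ▸ hQ2) h5.symm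
  obtain ⟨R, hR, hπR⟩ := exists_projection_lift_of_MvNEquivalent hπ hp1 hT hequiv
  -- The lift `a` of `p` is completed to the lift `a ⊕ D` of `p ⊕ 1 ⊕ 0`, where `D = 1 ⊕ 0`. As `D`
  -- is a projection, `exp(2πi (a ⊕ D)) = exp(2πi a) ⊕ 1`, and `R` is a projection with the same image.
  let κ := Fin m ⊕ ((Fin n ⊕ Fin k) ⊕ Fin m)
  obtain ⟨K, hK, hKr⟩ : ∃ K, ∃ _ : p.size ≤ K, K - p.size = Fintype.card κ :=
    ⟨p.size + Fintype.card κ, Nat.le_add_right _ _, Nat.add_sub_cancel_left ..⟩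
  let g : κ ≃ Fin (K - p.size) := (Fintype.equivFin κ).trans (finCongr hKr.symm)
  let f : Fin p.size ⊕ Fin (K - p.size) ≃ Fin K :=
    finSumFinEquiv.trans (finCongr (Nat.add_sub_cancel' hK))
  let D : CStarMatrix (Fin (K - p.size)) (Fin (K - p.size)) B :=
    (fromBlocks 1 0 0 0 : Matrix κ κ B).submatrix g.symm g.symm
  have hD : IsStarProjection D :=
    isStarProjection_submatrix (isStarProjection_fromBlocks (.one _) (.zero _)) _
  let l : Fin K ≃ (Fin p.size ⊕ Fin m) ⊕ ((Fin n ⊕ Fin k) ⊕ Fin m) :=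
    f.symm.trans (((Equiv.refl _).sumCongr g.symm).trans (Equiv.sumAssoc _ _ _).symm)
  -- The reindexing `l` matches the rows of `a ⊕ D` with those of `R`.
  have hl1 : ∀ b, l (f (Sum.inl b)) = Sum.inl (Sum.inl b) := fun b => by
    simp [l]; rfl
  have hl2 : ∀ b, l (f (Sum.inr (g (Sum.inl b)))) = Sum.inl (Sum.inr b) := fun b => by
    simp [l]; rfl
  have hl3 : ∀ b, l (f (Sum.inr (g (Sum.inr b)))) = Sum.inr b := fun b => by
    simp [l]; rfl
  have hDg : ∀ b c, D (g b) (g c) = (fromBlocks 1 0 0 0 : Matrix κ κ B) b c := fun b c => by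
    show (fromBlocks 1 0 0 0 : Matrix κ κ B) (g.symm (g b)) (g.symm (g c)) = _
    rw [g.symm_apply_apply, g.symm_apply_apply]
  have hlift : (blockSum f (a, D)).map π = CStarMatrix.map (R.submatrix l l) π := by
    ext i j
    show π (blockSum f (a, D) i j) = (R.map π) (l i) (l j)
    rw [hπR]
    obtain ⟨b | b, rfl⟩ := f.surjective i <;> obtain ⟨c | c, rfl⟩ := f.surjective j
    · rw [blockSum_apply_inl_inl, hl1, hl1]
      exact hap b c
    · obtain ⟨c | c, rfl⟩ := g.surjective c
      · rw [blockSum_apply_inl_inr, hl1, hl2]; simp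
      · rw [blockSum_apply_inl_inr, hl1, hl3]; simp
    · obtain ⟨b | b, rfl⟩ := g.surjective b
      · rw [blockSum_apply_inr_inl, hl1, hl2]; simp
      · rw [blockSum_apply_inr_inl, hl1, hl3]; simp
    · rw [blockSum_apply_inr_inr]
      obtain ⟨b | b, rfl⟩ := g.surjective b <;> obtain ⟨c | c, rfl⟩ := g.surjective c
      · show π (D _ _) = _
        rw [hDg, hl2, hl2]
        simp [Matrix.one_apply, apply_ite π]
      · show π (D _ _) = _
        rw [hDg, hl2, hl3]; simp
      · show π (D _ _) = _
        rw [hDg, hl2, hl3]; simp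
      · show π (D _ _) = _
        rw [hDg, hl3, hl3]; simp
  have hj : Joined (MatrixUnitary.pad hK v) 1 := by
    refine joined_one_of_projection_lift hJ (a := blockSum f (a, D)) (P := R.submatrix l l) ?_
      (isStarProjection_submatrix hR l) hlift _ fun i j => ?_
    · have : IsSelfAdjoint (a, D) := Prod.ext ha.star_eq hD.isSelfAdjoint.star_eq
      exact this.map (blockSum f)
    · rw [← map_smul, Prod.smul_mk, exp_blockSum,
        exp_two_pi_I_smul_of_isIdempotentElem hD.isIdempotentElem]
      obtain ⟨i, rfl⟩ := f.surjective i
      obtain ⟨j, rfl⟩ := f.surjective j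
      show unitizationInclusion J ((fromBlocks v.1 0 0 1 : Matrix _ _ (Unitization ℂ J))
        (f.symm (f i)) (f.symm (f j))) = _
      rw [f.symm_apply_apply, f.symm_apply_apply]
      rcases i with b | b <;> rcases j with c | c
      · rw [blockSum_apply_inl_inl]; exact hv b c
      · rw [blockSum_apply_inl_inr]; simp
      · rw [blockSum_apply_inr_inl]; simp
      · rw [blockSum_apply_inr_inr, fromBlocks_apply₂₂, Matrix.one_apply]
        show _ = (1 : CStarMatrix _ _ B) b c
        rw [CStarMatrix.one_apply]
        split_ifs <;> simp
  rw [← K1.mk_one K]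
  refine Quotient.sound (s := MatrixUnitary.setoid) ⟨K, hK, le_rfl, ?_⟩
  have h1 : MatrixUnitary.pad le_rfl (1 : unitary (Matrix (Fin K) (Fin K) (Unitization ℂ J))) = 1 :=
    Subtype.ext (MatrixUnitary.padMatrix_one le_rfl)
  exact (congrArg (Joined (MatrixUnitary.pad hK v)) h1).mpr hj

end ExponentialMap

/-! ### Spectral gaps -/

section Gap

variable {A B : Type u} [CStarAlgebra A] [CStarAlgebra B]

/-- The spectral projection `χ(b ≤ x)`, which is meaningful for `x` outside the spectrum of `b`. -/
noncomputable def spectralCut (b : B) (x : ℝ) : B :=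
  cfc (Set.indicator (Set.Iic x) (1 : ℝ → ℝ)) b

/-- For a point `x` in the gap `G`, the spectrum below `G` is the spectrum below `x`. -/
theorem gapProjection_eq_spectralCut {h : A} {G : Set ℝ} (hG : IsSpectralGap h G) {x : ℝ}
    (hx : x ∈ G) :
    gapProjection h G = spectralCut h x := by
  obtain ⟨z, hz, rfl⟩ := hG
  refine cfc_congr fun t ht => ?_
  have hiff : t ∈ lowerBounds (connectedComponentIn (spectrum ℝ h)ᶜ z) ↔ t ∈ Set.Iic x := by
    refine ⟨fun hl => hl hx, fun htx s hs => ?_⟩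
    by_contra! hst
    have hI := isPreconnected_connectedComponentIn (x := z) (F := (spectrum ℝ h)ᶜ)
    exact connectedComponentIn_subset _ _ (hI.ordConnected.out hs hx ⟨hst.le, htx⟩) ht
  by_cases h1 : t ∈ Set.Iic x
  · rw [Set.indicator_of_mem h1, Set.indicator_of_mem (hiff.2 h1)]
  · rw [Set.indicator_of_notMem h1, Set.indicator_of_notMem fun h2 => h1 (hiff.1 h2)]

theorem continuousOn_indicator_Iic {s : Set ℝ} {x : ℝ} (hx : x ∉ s) :
    ContinuousOn (Set.indicator (Set.Iic x) (1 : ℝ → ℝ)) s := by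
  intro t ht
  refine ContinuousAt.continuousWithinAt ?_
  rcases lt_or_gt_of_ne (show t ≠ x from fun h => hx (h ▸ ht)) with h | h
  · refine (continuousAt_const (y := (1 : ℝ))).congr ?_
    filter_upwards [Iio_mem_nhds h] with y hy
    have : Set.indicator (Set.Iic x) (1 : ℝ → ℝ) y = 1 :=
      Set.indicator_of_mem (Set.mem_Iic.2 (Set.mem_Iio.1 hy).le) _
    exact this.symm
  · refine (continuousAt_const (y := (0 : ℝ))).congr ?_
    filter_upwards [Ioi_mem_nhds h] with y hy
    have : Set.indicator (Set.Iic x) (1 : ℝ → ℝ) y = 0 :=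
      Set.indicator_of_notMem (fun h' => not_lt.2 (Set.mem_Iic.1 h') (Set.mem_Ioi.1 hy)) _
    exact this.symm

theorem map_spectralCut (φ : B →⋆ₐ[ℂ] A) {b : B} (hb : IsSelfAdjoint b) {x : ℝ}
    (hx : x ∉ spectrum ℝ b) :
    φ (spectralCut b x) = spectralCut (φ b) x := by
  have hc := continuousOn_indicator_Iic hx
  open scoped CStarAlgebra in
  have hφ : Continuous φ := map_continuous φ
  exact StarAlgHomClass.map_cfc (φ.restrictScalars ℝ) _ b hc hφ hb (hb.map φ)

theorem isStarProjection_spectralCut (b : B) {x : ℝ} (hx : x ∉ spectrum ℝ b) :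
    IsStarProjection (spectralCut b x) := by
  have hc := continuousOn_indicator_Iic hx
  refine ⟨?_, cfc_predicate _ b⟩
  rw [IsIdempotentElem, spectralCut, ← cfc_mul _ _ b hc hc]
  refine cfc_congr fun t _ => ?_
  by_cases ht : t ∈ Set.Iic x <;> simp [Set.indicator, ht]

variable {Ω : Type u} [TopologicalSpace Ω] [CompactSpace Ω] {d : ℕ}
  [AddAction (Fin (d + 1) → ℤ) Ω] [ContinuousConstVAdd (Fin (d + 1) → ℤ) Ω] {N : ℕ}

/-- If the spectrum of a lift `hhat` of `h` omits a point `x` of the gap `G`, then the spectral cut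
of `hhat` at `x` is a projection that lifts the gap projection of `h`. -/
theorem Exp_gapClass_eq_one_of_notMem_spectrum
    {h : CStarMatrix (Fin N) (Fin N) (BulkAlgebra Ω d)} {G : Set ℝ} (hG : IsSpectralGap h G)
    {hhat : CStarMatrix (Fin N) (Fin N) (HalfSpaceAlgebra Ω d)} (hhatsa : IsSelfAdjoint hhat)
    (hev : hhat.map (ev Ω d) = h) {x : ℝ} (hx : x ∈ G) (hxs : x ∉ spectrum ℝ hhat) :
    Exp Ω d (gapClass h G) = 1 := by
  have hlift : (spectralCut hhat x).map (ev Ω d) = gapProjection h G := by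
    rw [gapProjection_eq_spectralCut hG hx, ← hev]
    exact map_spectralCut (cstarMatrixMap (Fin N) (ev Ω d)) hhatsa hxs
  rw [Exp, exponentialMap]
  split_ifs with hex
  · exact eq_one_of_isExponential_of_lift ev_surjective (fun b => ev_eq_zero_iff)
      (isStarProjection_spectralCut hhat hxs) (isStarProjection_gapProjection h G) hlift
      hex.choose_spec
  · rfl

end Gap

end BulkBoundary

theorem mainTheorem1 {Ω : Type u} [TopologicalSpace Ω] [CompactSpace Ω] [T2Space Ω] (d : ℕ)
    [AddAction (Fin (d + 1) → ℤ) Ω] [ContinuousConstVAdd (Fin (d + 1) → ℤ) Ω] (N : ℕ)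
    (h : CStarMatrix (Fin N) (Fin N) (BulkBoundary.BulkAlgebra Ω d)) (hsa : IsSelfAdjoint h)
    (G : Set ℝ) (hG : BulkBoundary.IsSpectralGap h G)
    (hExp : BulkBoundary.Exp Ω d (BulkBoundary.gapClass h G) ≠ 1)
    (hhat : CStarMatrix (Fin N) (Fin N) (BulkBoundary.HalfSpaceAlgebra Ω d))
    (hhatsa : IsSelfAdjoint hhat) (hev : hhat.map (BulkBoundary.ev Ω d) = h) :
    BulkBoundary.boundarySpectrum hhat ∩ G = G := by
  have hGh : G ⊆ (spectrum ℝ h)ᶜ := by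
    obtain ⟨z, _, rfl⟩ := hG
    exact connectedComponentIn_subset _ _
  refine Set.inter_eq_right.2 fun x hx => ⟨?_, hev.symm ▸ hGh hx⟩
  by_contra hxs
  exact hExp (BulkBoundary.Exp_gapClass_eq_one_of_notMem_spectrum hG hhatsa hev hx hxs)
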